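/- Let $R$ be a commutative ring and let $T:\mathrm{Mod}_R\to\mathrm{Ab}$ be a functor with $T(0)=0$. For an $R$-module $M$ and $i,n\ge 0$, the non-abelian derived functor of type $n$ is $L^{(n)}_iT(M)=\pi_i(T(M_\bullet))$, where $M_\bullet$ is a level-wise free simplicial $R$-module whose only homotopy group is $M$, in degree $n$ (and $T$ is applied level-wise). A level-wise split exact sequence $0\to M_\bullet\to E_\bullet\to B_\bullet\to 0$ of level-wise free simplicial modules with $E_\bullet$ contractible gives the Dold–Puppe suspension map $\sigma^{(n)}_i:L^{(n)}_iT(M)\to L^{(n+1)}_{i+1}T(M)$: a cycle of $T(M_\bullet)$ is a boundary in $T(E_\bullet)$, of a chain whose image in $T(B_\bullet)$ is a cycle. The left stable derived functors of $T$ are $$L^s_qT(M)=\operatorname{colim}\bigl(L^{(0)}_qT(M)\xrightarrow{\sigma^{(0)}_q}L^{(1)}_{q+1}T(M)\xrightarrow{\sigma^{(1)}_{q+1}}L^{(2)}_{q+2}T(M)\to\cdots\bigr).$$ Let $F_R:\mathrm{Mod}_R\to\mathrm{Ab}$ be $F_R(M)=(M\otimes_RM)^{C_2}$, where $C_2$ swaps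 the two factors. Let $\Lambda_R:\mathrm{Mod}_R\to\mathrm{Mod}_R$ be J. H. C. Whitehead's functor: $\Lambda_R(M)$ is the $R$-module generated by symbols $\lambda(m)$, $m\in M$, subject to $\lambda(rm)=r^2\lambda(m)$ and to the bilinearity over $R$ of $(m,n)\mapsto\lambda(m+n)-\lambda(m)-\lambda(n)$. **Proposition.** (i) For every integer $q\ge 0$, $$L^s_qF_{\mathbb Z/4}(\mathbb Z/2)\cong(\mathbb Z/2)^{q+1}.$$ (ii) The restrictions of $F_{\mathbb Z/4}$ and of $\Lambda_{\mathbb Z/4}$ to the category of free $\mathbb Z/4$-modules are naturally isomorphic, as functors to abelian groups. -/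

import Mathlib

open CategoryTheory

noncomputable section

namespace StableDerived

open CategoryTheory.Limits AlgebraicTopology Opposite
open scoped TensorProduct

universe u

/-! ### Homotopy groups of simplicial objects in an abelian category -/

/-- The `i`-th homotopy group of a simplicial object of an abelian category: the homology in
degree `i` of its Moore complex (boundary: the alternating sum of the faces). -/
abbrev simplicialHomotopy {C : Type*} [Category* C] [Abelian C] (X : SimplicialObject C) (i : ℕ) :
    C :=
  ((alternatingFaceMapComplex C).obj X).homology i

open scoped Simplicial in
/-- `X` is a level-wise free simplicial `R`-module whose realisation is the `n`-fold suspension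
of (the Eilenberg-MacLane spectrum of) `M`: its only homotopy group is `M`, in degree `n`. -/
structure IsFreeModel {R : Type u} [CommRing R] (M : ModuleCat.{u} R) (n : ℕ)
    (X : SimplicialObject (ModuleCat.{u} R)) : Prop where
  free (m : ℕ) : Module.Free R (X _⦋m⦌)
  isZero (i : ℕ) (hi : i ≠ n) : IsZero (simplicialHomotopy X i)
  nonempty_iso : Nonempty (simplicialHomotopy X n ≅ M)

/-! Inequalities between vertices of simplices, used for the contraction of the cone. -/

lemma lt_succAbove_of_le {n : ℕ} (i : Fin (n + 2)) (j : Fin (n + 1)) (hij : i ≤ j.castSucc)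
    (k : Fin (n + 2)) : j.succ.castSucc < i.castSucc.succAbove k ↔ j.castSucc < k := by
  simp only [Fin.succAbove, Fin.lt_def, Fin.le_def] at *
  split_ifs <;> simp_all
  omega

lemma lt_succAbove_self {n : ℕ} (j : Fin (n + 1)) (k : Fin (n + 2)) :
    j.succ.castSucc < j.castSucc.succ.succAbove k ↔
      j.castSucc.castSucc < j.castSucc.succ.succAbove k := by
  simp only [Fin.succAbove, Fin.lt_def] at *
  split_ifs <;> simp_all <;> omega

lemma lt_succAbove_of_lt {n : ℕ} (i : Fin (n + 2)) (j : Fin (n + 1)) (hji : j.castSucc < i)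
    (k : Fin (n + 2)) : j.castSucc.castSucc < i.succ.succAbove k ↔ j.castSucc < k := by
  simp only [Fin.succAbove, Fin.lt_def] at *
  split_ifs <;> simp_all
  omega

lemma lt_predAbove_of_le {n : ℕ} (i j : Fin (n + 1)) (hij : i ≤ j) (k : Fin (n + 3)) :
    j.castSucc < i.castSucc.predAbove k ↔ j.succ.castSucc < k := by
  by_cases h : i.castSucc.castSucc < k
  · rw [Fin.predAbove_of_castSucc_lt _ _ h]
    have h₁ : (i : ℕ) < k := h
    have h₂ : (i : ℕ) ≤ j := hij
    change (j : ℕ) < (k : ℕ) - 1 ↔ (j : ℕ) + 1 < k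
    omega
  · rw [Fin.predAbove_of_le_castSucc _ _ (not_lt.1 h)]
    have h₁ : ¬ (i : ℕ) < k := h
    have h₂ : (i : ℕ) ≤ j := hij
    change (j : ℕ) < k ↔ (j : ℕ) + 1 < k
    omega

lemma lt_predAbove_of_lt {n : ℕ} (i j : Fin (n + 1)) (hji : j ≤ i) (k : Fin (n + 3)) :
    j.castSucc < i.succ.predAbove k ↔ j.castSucc.castSucc < k := by
  by_cases h : i.succ.castSucc < k
  · rw [Fin.predAbove_of_castSucc_lt _ _ h]
    have h₁ : (i : ℕ) + 1 < k := h
    have h₂ : (j : ℕ) ≤ i := hji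
    change (j : ℕ) < (k : ℕ) - 1 ↔ (j : ℕ) < k
    omega
  · rw [Fin.predAbove_of_le_castSucc _ _ (not_lt.1 h)]
    have h₁ : ¬ (i : ℕ) + 1 < k := h
    have h₂ : (j : ℕ) ≤ i := hji
    change (j : ℕ) < k ↔ (j : ℕ) < k
    omega

/-! ### The cone and the suspension of a simplicial module -/

section Bar

open scoped Simplicial

variable {R : Type u} [CommRing R]

/-- The contractible simplicial module `E X`, with `(E X)ₙ = (Xₙ)ⁿ⁺¹`, the functions from the
vertices of the `n`-simplex to `Xₙ`. -/
def cone (X : SimplicialObject (ModuleCat.{u} R)) : SimplicialObject (ModuleCat.{u} R) where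
  obj n := ModuleCat.of R (Fin (n.unop.len + 1) → X.obj n)
  map α := ModuleCat.ofHom
    (LinearMap.pi fun k => (X.map α).hom ∘ₗ LinearMap.proj (α.unop.toOrderHom k))
  map_id n := by
    refine ModuleCat.hom_ext (LinearMap.ext fun f => funext fun k => ?_)
    simp
  map_comp α β := by
    refine ModuleCat.hom_ext (LinearMap.ext fun f => funext fun k => ?_)
    simp

lemma cone_map_apply (X : SimplicialObject (ModuleCat.{u} R)) {m n : SimplexCategoryᵒᵖ}
    (α : m ⟶ n) (f : Fin (m.unop.len + 1) → X.obj m) (k : Fin (n.unop.len + 1)) :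
    ((cone X).map α).hom f k = (X.map α).hom (f (α.unop.toOrderHom k)) := rfl

/-- The inclusion `X → E X` as the constant functions. -/
def toCone (X : SimplicialObject (ModuleCat.{u} R)) : X ⟶ cone X where
  app _ := ModuleCat.ofHom (LinearMap.pi fun _ => LinearMap.id)
  naturality _ _ _ := rfl

/-- The suspension `B X = E X / X` of a simplicial module (the diagonal of the bar
construction, `(B X)ₙ ≅ (Xₙ)ⁿ`): there is a short exact sequence `0 → X → E X → B X → 0`. -/
def suspension (X : SimplicialObject (ModuleCat.{u} R)) : SimplicialObject (ModuleCat.{u} R) where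
  obj n := ModuleCat.of R ((Fin (n.unop.len + 1) → X.obj n) ⧸ LinearMap.range ((toCone X).app n).hom)
  map {m n} α := ModuleCat.ofHom (Submodule.mapQ _ _ ((cone X).map α).hom (by
    rintro _ ⟨x, rfl⟩
    exact ⟨(X.map α).hom x, rfl⟩))
  map_id n := by
    refine ModuleCat.hom_ext (Submodule.linearMap_qext _ (LinearMap.ext fun f => ?_))
    exact congrArg (Submodule.Quotient.mk) (congrArg (fun g => g.hom f) ((cone X).map_id n))
  map_comp α β := by
    refine ModuleCat.hom_ext (Submodule.linearMap_qext _ (LinearMap.ext fun f => ?_))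
    exact congrArg (Submodule.Quotient.mk) (congrArg (fun g => g.hom f) ((cone X).map_comp α β))

/-- The projection `E X → B X`. -/
def fromCone (X : SimplicialObject (ModuleCat.{u} R)) : cone X ⟶ suspension X where
  app n := ModuleCat.ofHom (LinearMap.range ((toCone X).app n).hom).mkQ
  naturality _ _ _ := rfl

lemma toCone_fromCone (X : SimplicialObject (ModuleCat.{u} R)) :
    toCone X ≫ fromCone X = 0 := by
  ext n x
  exact (Submodule.Quotient.mk_eq_zero _).2 ⟨x, rfl⟩

open Classical in
/-- Set to zero the values of `f ∈ (E X)ₙ` at the vertices outside `s`. -/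
def restrictTo (X : SimplicialObject (ModuleCat.{u} R)) (n : SimplexCategoryᵒᵖ)
    (s : Fin (n.unop.len + 1) → Prop) : (cone X).obj n ⟶ (cone X).obj n :=
  ModuleCat.ofHom (LinearMap.pi fun k => if s k then LinearMap.proj k else 0)

open Classical in
lemma restrictTo_apply (X : SimplicialObject (ModuleCat.{u} R)) (n : SimplexCategoryᵒᵖ)
    (s : Fin (n.unop.len + 1) → Prop) (f : Fin (n.unop.len + 1) → X.obj n)
    (k : Fin (n.unop.len + 1)) :
    (restrictTo X n s).hom f k = if s k then f k else 0 := by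
  change (if s k then LinearMap.proj k else 0 : (Fin (n.unop.len + 1) → X.obj n) →ₗ[R] X.obj n) f = _
  split_ifs <;> rfl

lemma restrictTo_comp_map (X : SimplicialObject (ModuleCat.{u} R)) {m n : SimplexCategoryᵒᵖ}
    (α : m ⟶ n) (s : Fin (m.unop.len + 1) → Prop) :
    restrictTo X m s ≫ (cone X).map α =
      (cone X).map α ≫ restrictTo X n (fun k => s (α.unop.toOrderHom k)) := by
  classical
  refine ModuleCat.hom_ext (LinearMap.ext fun f => funext fun k => ?_)
  refine (congrArg (X.map α).hom (restrictTo_apply X m s f _)).trans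
    (Eq.trans ?_ (restrictTo_apply X n (fun k => s (α.unop.toOrderHom k)) _ k).symm)
  split_ifs
  · rfl
  · exact map_zero _

lemma restrictTo_true (X : SimplicialObject (ModuleCat.{u} R)) (n : SimplexCategoryᵒᵖ)
    (s : Fin (n.unop.len + 1) → Prop) (hs : ∀ k, s k) : restrictTo X n s = 𝟙 _ := by
  classical
  refine ModuleCat.hom_ext (LinearMap.ext fun f => funext fun k => ?_)
  exact (restrictTo_apply X n s f k).trans (if_pos (hs k))

lemma restrictTo_false (X : SimplicialObject (ModuleCat.{u} R)) (n : SimplexCategoryᵒᵖ)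
    (s : Fin (n.unop.len + 1) → Prop) (hs : ∀ k, ¬ s k) : restrictTo X n s = 0 := by
  classical
  refine ModuleCat.hom_ext (LinearMap.ext fun f => funext fun k => ?_)
  exact (restrictTo_apply X n s f k).trans (if_neg (hs k))

lemma restrictTo_comp_δ (X : SimplicialObject (ModuleCat.{u} R)) {n : ℕ} (i : Fin (n + 2))
    (s : Fin (n + 2) → Prop) :
    restrictTo X (op ⦋n + 1⦌) s ≫ (cone X).δ i =
      (cone X).δ i ≫ restrictTo X (op ⦋n⦌) (fun k : Fin (n + 1) => s (i.succAbove k)) :=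
  restrictTo_comp_map X (SimplexCategory.δ i).op s

lemma restrictTo_comp_σ (X : SimplicialObject (ModuleCat.{u} R)) {n : ℕ} (i : Fin (n + 1))
    (s : Fin (n + 1) → Prop) :
    restrictTo X (op ⦋n⦌) s ≫ (cone X).σ i =
      (cone X).σ i ≫ restrictTo X (op ⦋n + 1⦌) (fun k : Fin (n + 2) => s (i.predAbove k)) :=
  restrictTo_comp_map X (SimplexCategory.σ i).op s

/-- The standard contraction of `E X`: a simplicial homotopy between zero and the identity. -/
def coneContraction (X : SimplicialObject (ModuleCat.{u} R)) :
    SimplicialObject.Homotopy (0 : cone X ⟶ cone X) (𝟙 (cone X)) where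
  h {n} i := (cone X).σ i ≫ restrictTo X (op ⦋n + 1⦌) (fun k : Fin (n + 2) => i.castSucc < k)
  h_zero_comp_δ_zero n := by
    rw [Category.assoc, restrictTo_comp_δ, restrictTo_true, Category.comp_id]
    · exact (cone X).δ_comp_σ_self (i := 0)
    · intro k
      exact Fin.pos_iff_ne_zero.2 (Fin.succAbove_ne _ k)
  h_last_comp_δ_last n := by
    rw [Category.assoc, restrictTo_comp_δ, restrictTo_false]
    · simp
    · intro k
      simp [Fin.succAbove_last, Fin.le_last]
  h_succ_comp_δ_castSucc_of_lt i j hij := by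
    rw [Category.assoc, restrictTo_comp_δ, SimplicialObject.δ_comp_σ_of_le_assoc _ hij]
    congr 3
    exact funext fun k => propext (lt_succAbove_of_le i j hij k)
  h_succ_comp_δ_castSucc_succ j := by
    rw [Category.assoc, Category.assoc, restrictTo_comp_δ, restrictTo_comp_δ,
      SimplicialObject.δ_comp_σ_self'_assoc _ (Fin.succ_castSucc j),
      SimplicialObject.δ_comp_σ_succ'_assoc _ rfl]
    congr 1
    exact funext fun k => propext (lt_succAbove_self j k)
  h_castSucc_comp_δ_succ_of_lt i j hji := by
    rw [Category.assoc, restrictTo_comp_δ, SimplicialObject.δ_comp_σ_of_gt_assoc _ hji]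
    congr 3
    exact funext fun k => propext (lt_succAbove_of_lt i j hji k)
  h_comp_σ_castSucc_of_le i j hij := by
    rw [Category.assoc, restrictTo_comp_σ, SimplicialObject.σ_comp_σ_assoc _ hij]
    congr 3
    exact funext fun k => propext (lt_predAbove_of_le i j hij k)
  h_comp_σ_succ_of_lt i j hji := by
    rw [Category.assoc, restrictTo_comp_σ, ← SimplicialObject.σ_comp_σ_assoc _ hji]
    congr 3
    exact funext fun k => propext (lt_predAbove_of_lt i j hji k)

/-- `E X` is contractible. -/
lemma isZero_simplicialHomotopy_cone (X : SimplicialObject (ModuleCat.{u} R)) (i : ℕ) :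
    IsZero (simplicialHomotopy (cone X) i) := by
  have h := (coneContraction X).map_homology_eq i
  rw [Functor.map_zero, Functor.map_zero, CategoryTheory.Functor.map_id,
    CategoryTheory.Functor.map_id] at h
  exact (IsZero.iff_id_eq_zero _).2 h.symm

/-- The sequence of Moore complexes of `X → E X → B X`. -/
def coneSequence (X : SimplicialObject (ModuleCat.{u} R)) :
    ShortComplex (ChainComplex (ModuleCat.{u} R) ℕ) :=
  ShortComplex.mk ((alternatingFaceMapComplex _).map (toCone X))
    ((alternatingFaceMapComplex _).map (fromCone X)) (by
      rw [← Functor.map_comp, toCone_fromCone, Functor.map_zero])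

lemma coneSequence_shortExact (X : SimplicialObject (ModuleCat.{u} R)) :
    (coneSequence X).ShortExact := by
  refine HomologicalComplex.shortExact_of_degreewise_shortExact _ fun i => ?_
  have : Mono ((coneSequence X).map (HomologicalComplex.eval _ _ i)).f := by
    refine (ModuleCat.mono_iff_injective _).2 fun x y h => ?_
    exact congrFun h (0 : Fin (i + 1))
  have : Epi ((coneSequence X).map (HomologicalComplex.eval _ _ i)).g := by
    refine (ModuleCat.epi_iff_surjective _).2 ?_
    exact Submodule.mkQ_surjective _
  refine ⟨?_⟩
  rw [ShortComplex.moduleCat_exact_iff]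
  intro x hx
  exact (Submodule.Quotient.mk_eq_zero _).1 hx

/-- If `X` is a free model of the `n`-fold suspension of `M`, then `B X` is one of the
`(n + 1)`-fold suspension of `M`. -/
theorem IsFreeModel.suspension {M : ModuleCat.{u} R} {n : ℕ}
    {X : SimplicialObject (ModuleCat.{u} R)} (h : IsFreeModel M n X) :
    IsFreeModel M (n + 1) (suspension X) := by
  have iso (i : ℕ) : simplicialHomotopy (StableDerived.suspension X) (i + 1) ≅
      simplicialHomotopy X i :=
    (coneSequence_shortExact X).δIso (i + 1) i (by simp)
      (isZero_simplicialHomotopy_cone X _) (isZero_simplicialHomotopy_cone X _)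
  refine ⟨fun m => ?_, fun i hi => ?_, ?_⟩
  · have := h.free m
    let e : ((Fin (m + 1) → X _⦋m⦌) ⧸ LinearMap.range ((toCone X).app (op ⦋m⦌)).hom) ≃ₗ[R]
        (Fin m → X _⦋m⦌) := by
      let g : (Fin (m + 1) → X _⦋m⦌) →ₗ[R] (Fin m → X _⦋m⦌) :=
        LinearMap.funLeft R _ Fin.succ - LinearMap.pi fun _ => LinearMap.proj 0
      refine (Submodule.quotEquivOfEq _ (LinearMap.ker g) ?_).trans
        (g.quotKerEquivOfSurjective ?_)
      · ext f
        constructor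
        · rintro ⟨x, rfl⟩
          exact funext fun k => sub_self x
        · intro hf
          refine ⟨f 0, funext fun k => ?_⟩
          refine Fin.cases rfl (fun k => ?_) k
          exact (sub_eq_zero.1 (congrFun hf k)).symm
      · intro y
        refine ⟨Fin.cons 0 y, ?_⟩
        ext k
        simp [g, LinearMap.funLeft]
    exact Module.Free.of_equiv e.symm
  · cases i with
    | zero =>
      have hS := coneSequence_shortExact X
      have hE : Epi (HomologicalComplex.homologyMap (coneSequence X).g 0) := by
        have : Epi (coneSequence X).g := hS.epi_g
        exact HomologicalComplex.epi_homologyMap_of_epi_of_not_rel _ _ (by simp)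
      exact @IsZero.of_epi _ _ _ _ _ (HomologicalComplex.homologyMap (coneSequence X).g 0) hE
        (isZero_simplicialHomotopy_cone X 0)
    | succ i => exact (h.isZero i (by omega)).of_iso (iso i)
  · exact ⟨iso n ≪≫ h.nonempty_iso.some⟩

end Bar

/-! ### Non-abelian derived functors and the suspension maps -/

section Derived

variable {R : Type u} [CommRing R] (T : ModuleCat.{u} R ⥤ AddCommGrpCat.{u})

/-- The simplicial abelian group obtained by applying `T` level-wise. -/
abbrev applyLevelwise (X : SimplicialObject (ModuleCat.{u} R)) :
    SimplicialObject AddCommGrpCat.{u} :=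
  ((SimplicialObject.whiskering _ _).obj T).obj X

/-- `πᵢ (T X)`. If `X` is a level-wise free simplicial module whose only homotopy group is `M`, in
degree `n`, then this is the value at `M` of the `i`-th non-abelian derived functor of type `n`
of `T`. -/
abbrev leftDerived (X : SimplicialObject (ModuleCat.{u} R)) (i : ℕ) : AddCommGrpCat.{u} :=
  simplicialHomotopy (applyLevelwise T X) i

/-- A homotopy from the zero chain map to itself anticommutes with the boundaries, so it
induces maps of homology groups which raise the degree by one. -/
def homologyShift {C : Type*} [Category* C] [Abelian C] {A B : ChainComplex C ℕ}
    (K : Homotopy (0 : A ⟶ B) 0) (i : ℕ) : A.homology i ⟶ B.homology (i + 1) :=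
  ShortComplex.homologyMap
    (S₁ := A.sc i) (S₂ := B.sc (i + 1))
    { τ₁ := - K.hom _ _
      τ₂ := K.hom _ _
      τ₃ := - K.hom _ _
      comm₁₂ := by
        have h := K.comm ((ComplexShape.down ℕ).prev i)
        have hi : (ComplexShape.down ℕ).prev i = i + 1 := by simp
        have hi' : (ComplexShape.down ℕ).prev (i + 1) = i + 2 := by simp
        change (-K.hom _ _) ≫ B.d _ _ = A.d _ _ ≫ K.hom _ _
        rw [hi, hi']
        rw [hi, dNext_eq K.hom (i' := i) rfl, prevD_eq K.hom (j' := i + 2) rfl] at h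
        simp at h
        rw [Preadditive.neg_comp, neg_eq_iff_add_eq_zero]
        exact (add_comm _ _).trans h.symm
      comm₂₃ := by
        have h := K.comm i
        have hi' : (ComplexShape.down ℕ).next (i + 1) = i := by simp
        change K.hom _ _ ≫ B.d _ _ = A.d _ _ ≫ (-K.hom _ _)
        rw [hi']
        rw [prevD_eq K.hom (j' := i + 1) rfl] at h
        change _ = A.d i _ ≫ K.hom _ _ + _ + _ at h
        simp at h
        rw [Preadditive.comp_neg, eq_neg_iff_add_eq_zero]
        exact (add_comm _ _).trans h.symm }

lemma map_applyLevelwise_zero [T.PreservesZeroMorphisms]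
    {X Y : SimplicialObject (ModuleCat.{u} R)} (f : X ⟶ Y) (hf : f = 0) :
    (alternatingFaceMapComplex _).map (((SimplicialObject.whiskering _ _).obj T).map f) = 0 := by
  subst hf
  ext1 n
  exact T.map_zero _ _

/-- For `T 0 = 0`, the chain homotopy on `T X → T (B X)` obtained by restricting to `T X` the
contraction of `T (E X)`, and projecting to `T (B X)`. -/
def suspensionHomotopy [T.PreservesZeroMorphisms] (X : SimplicialObject (ModuleCat.{u} R)) :
    Homotopy (0 : (alternatingFaceMapComplex _).obj (applyLevelwise T X) ⟶
      (alternatingFaceMapComplex _).obj (applyLevelwise T (suspension X))) 0 :=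
  (Homotopy.ofEq (map_applyLevelwise_zero T _ (by simp)).symm).trans <|
    ((((coneContraction X).precomp (toCone X)).postcomp
      (fromCone X)).whiskerRight T).toChainHomotopy.trans <|
    Homotopy.ofEq (map_applyLevelwise_zero T _ (by rw [Category.comp_id, toCone_fromCone]))

/-- The suspension map `πᵢ (T X) → πᵢ₊₁ (T (B X))` of Dold and Puppe: a cycle of `T X` is the
boundary of a chain of the acyclic complex `T (E X)`, whose image in `T (B X)` is a cycle. -/
def suspensionMap [T.PreservesZeroMorphisms] (X : SimplicialObject (ModuleCat.{u} R)) (i : ℕ) :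
    leftDerived T X i ⟶ leftDerived T (suspension X) (i + 1) :=
  homologyShift (suspensionHomotopy T X) i

/-- The `n`-fold suspension. -/
def iteratedSuspension (X : SimplicialObject (ModuleCat.{u} R)) (n : ℕ) :
    SimplicialObject (ModuleCat.{u} R) :=
  match n with
  | 0 => X
  | n + 1 => suspension (iteratedSuspension X n)

lemma IsFreeModel.iteratedSuspension {M : ModuleCat.{u} R}
    {X : SimplicialObject (ModuleCat.{u} R)} (h : IsFreeModel M 0 X) (n : ℕ) :
    IsFreeModel M n (iteratedSuspension X n) := by
  induction n with
  | zero => exact h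
  | succ n ih => exact ih.suspension

/-- The sequence `L⁽⁰⁾_q T → L⁽¹⁾_{q+1} T → L⁽²⁾_{q+2} T → ⋯` of suspension maps, evaluated on
the suspensions of the model `X`. -/
def stableSequence [T.PreservesZeroMorphisms] (X : SimplicialObject (ModuleCat.{u} R)) (q : ℕ) :
    ℕ ⥤ AddCommGrpCat.{u} :=
  Functor.ofSequence (X := fun n => leftDerived T (iteratedSuspension X n) (q + n))
    (fun n => suspensionMap T (iteratedSuspension X n) (q + n))

/-- The `q`-th left stable derived functor of `T`, the colimit of the sequence of suspension maps,
computed from the free model `X`. -/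
def leftStableDerived [T.PreservesZeroMorphisms] (X : SimplicialObject (ModuleCat.{u} R)) (q : ℕ) :
    AddCommGrpCat.{u} :=
  colimit (stableSequence T X q)

end Derived

/-! ### The functors `F` and `Λ` -/

section Functors

variable (R : Type u) [CommRing R]

/-- `(M ⊗ M)^{C₂}`, the elements of `M ⊗ M` fixed by the interchange of the factors. -/
def symmetricTensors (M : Type u) [AddCommGroup M] [Module R M] : Submodule R (M ⊗[R] M) :=
  LinearMap.eqLocus (TensorProduct.comm R M M).toLinearMap LinearMap.id

/-- The map of symmetric tensors induced by a linear map. -/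
def symmetricTensorsMap {M N : Type u} [AddCommGroup M] [Module R M] [AddCommGroup N] [Module R N]
    (f : M →ₗ[R] N) : symmetricTensors R M →ₗ[R] symmetricTensors R N :=
  (TensorProduct.map f f).restrict fun x (hx : TensorProduct.comm R M M x = x) =>
    show TensorProduct.comm R N N (TensorProduct.map f f x) = TensorProduct.map f f x by
      rw [← TensorProduct.map_comm, hx]

/-- The functor `F_R : Mod_R → Ab`, `F_R(M) = (M ⊗ M)^{C₂}`. -/
def F : ModuleCat.{u} R ⥤ AddCommGrpCat.{u} where
  obj M := AddCommGrpCat.of (symmetricTensors R M)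
  map f := AddCommGrpCat.ofHom (symmetricTensorsMap R f.hom).toAddMonoidHom
  map_id M := by
    refine AddCommGrpCat.hom_ext (AddMonoidHom.ext fun x => Subtype.ext ?_)
    change TensorProduct.map LinearMap.id LinearMap.id x.1 = x.1
    rw [TensorProduct.map_id]
    rfl
  map_comp f g := by
    refine AddCommGrpCat.hom_ext (AddMonoidHom.ext fun x => Subtype.ext ?_)
    change TensorProduct.map (g.hom ∘ₗ f.hom) (g.hom ∘ₗ f.hom) x.1 =
      TensorProduct.map g.hom g.hom (TensorProduct.map f.hom f.hom x.1)
    rw [TensorProduct.map_comp]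
    rfl

instance : (F R).PreservesZeroMorphisms where
  map_zero M N := by
    refine AddCommGrpCat.hom_ext (AddMonoidHom.ext fun x => Subtype.ext ?_)
    change TensorProduct.map 0 0 x.1 = 0
    rw [TensorProduct.map_zero_left]
    rfl

/-- The relations of Whitehead's functor, in the free module on symbols `λ(m)`, `m ∈ M`:
`λ(rm) = r² λ(m)`, and `λ(m + n) - λ(m) - λ(n)` is bilinear in `(m, n)`; as it is symmetric,
linearity in `m` is enough. -/
inductive WhiteheadRel (M : Type u) [AddCommGroup M] [Module R M] : (M →₀ R) → Prop where
  | smul (r : R) (m : M) :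
      WhiteheadRel M (Finsupp.single (r • m) 1 - r ^ 2 • Finsupp.single m 1)
  | add_left (m m' n : M) :
      WhiteheadRel M
        ((Finsupp.single (m + m' + n) 1 - Finsupp.single (m + m') 1 - Finsupp.single n 1) -
          (Finsupp.single (m + n) 1 - Finsupp.single m 1 - Finsupp.single n 1) -
          (Finsupp.single (m' + n) 1 - Finsupp.single m' 1 - Finsupp.single n 1))
  | smul_left (r : R) (m n : M) :
      WhiteheadRel M
        ((Finsupp.single (r • m + n) 1 - Finsupp.single (r • m) 1 - Finsupp.single n 1) -
          r • (Finsupp.single (m + n) 1 - Finsupp.single m 1 - Finsupp.single n 1))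

/-- The submodule of the free module on `M` spanned by Whitehead's relations. -/
def whiteheadRelations (M : Type u) [AddCommGroup M] [Module R M] : Submodule R (M →₀ R) :=
  Submodule.span R {x | WhiteheadRel R M x}

lemma whiteheadRelations_le_comap {M N : Type u} [AddCommGroup M] [Module R M] [AddCommGroup N]
    [Module R N] (f : M →ₗ[R] N) :
    whiteheadRelations R M ≤ (whiteheadRelations R N).comap (Finsupp.lmapDomain R R f) := by
  refine Submodule.span_le.2 ?_
  rintro _ (⟨r, m⟩ | ⟨m, m', n⟩ | ⟨r, m, n⟩)
  · simp only [SetLike.mem_coe, Submodule.mem_comap, map_sub, map_smul,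
      Finsupp.lmapDomain_apply, Finsupp.mapDomain_single]
    exact Submodule.subset_span (WhiteheadRel.smul r (f m))
  · simp only [SetLike.mem_coe, Submodule.mem_comap, map_sub, map_add,
      Finsupp.lmapDomain_apply, Finsupp.mapDomain_single]
    exact Submodule.subset_span (WhiteheadRel.add_left (f m) (f m') (f n))
  · simp only [SetLike.mem_coe, Submodule.mem_comap, map_sub, map_add, map_smul,
      Finsupp.lmapDomain_apply, Finsupp.mapDomain_single]
    exact Submodule.subset_span (WhiteheadRel.smul_left r (f m) (f n))

/-- J. H. C. Whitehead's functor `Λ_R : Mod_R → Mod_R`. -/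
def Whitehead : ModuleCat.{u} R ⥤ ModuleCat.{u} R where
  obj M := ModuleCat.of R ((M →₀ R) ⧸ whiteheadRelations R M)
  map f := ModuleCat.ofHom
    (Submodule.mapQ _ _ (Finsupp.lmapDomain R R f.hom) (whiteheadRelations_le_comap R f.hom))
  map_id M := by
    refine ModuleCat.hom_ext (Submodule.linearMap_qext _ (Finsupp.lhom_ext fun m r => ?_))
    exact congrArg Submodule.Quotient.mk (Finsupp.mapDomain_single)
  map_comp f g := by
    refine ModuleCat.hom_ext (Submodule.linearMap_qext _ (Finsupp.lhom_ext fun m r => ?_))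
    refine congrArg Submodule.Quotient.mk ?_
    change Finsupp.mapDomain _ _ = Finsupp.mapDomain _ (Finsupp.mapDomain _ _)
    rw [Finsupp.mapDomain_single, Finsupp.mapDomain_single, Finsupp.mapDomain_single]
    rfl

/-- The full subcategory of free `R`-modules. -/
abbrev FreeModuleCat : Type (u + 1) :=
  ObjectProperty.FullSubcategory fun M : ModuleCat.{u} R => Module.Free R M

/-- The inclusion of the free modules into all modules. -/
abbrev freeInclusion : FreeModuleCat R ⥤ ModuleCat.{u} R :=
  ObjectProperty.ι _

end Functors

/-- `ℤ/2` as a `ℤ/4`-module. -/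
def zmodTwo : ModuleCat.{0} (ZMod 4) :=
  (ModuleCat.restrictScalars (ZMod.castHom (by norm_num : 2 ∣ 4) (ZMod 2))).obj
    (ModuleCat.of (ZMod 2) (ZMod 2))

end StableDerived

end

noncomputable section

namespace StableDerived

/-! ### Stable homology of a tower of complexes -/

/-! Let `M` be a level of a suspension of a free model of `ℤ/2`, let `τ` be the interchange on `M ⊗
M`, and let `E_ε` consist of the tensors on which `τ` acts by the sign `ε`, so that `E_1 = F(M)`.
Let `N_ε ⊆ E_ε` be the image of the norm `1 + ετ`, whose kernel is `E_{-ε}`. There are exact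
sequences `0 → E_{-ε} → M ⊗ M → N_ε → 0` and `0 → N_ε → E_ε → M/2 → 0`, the last map being inverse
to `u ↦ c (u ⊗ u)` with `c = 1` for `ε = 1` and `c = 2` for `ε = -1`. That the Tate cohomology is
`M/2` for both signs is special to `ℤ/4`.

Three facts determine the stable homology. That of `M ⊗ M` vanishes, because a homotopy may move one
factor only (`exists_extS_eq_extD`); hence `H_q(N_ε) ≅ H_{q-1}(E_{-ε})`. That of `M/2` is `Tor` of
`ℤ/2` with itself over `ℤ/4`, a copy of `ℤ/2` in each degree `q ≥ 0` (`extBoundaryTwo_iff`). Finally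
`H(E_ε) → H(M/2)` is onto: a normalised cycle `u` modulo two has all faces even, and `(2t) ⊗ (2t) =
4 (t ⊗ t) = 0`, so `c (u ⊗ u)` is an honest cycle (`exists_cycle_mem_extRel`). So the long exact
sequence breaks up and `|H_q(E_ε)| = 2 |H_{q-1}(E_{-ε})|` (`card_eq_two_mul`), which gives the order
`2^{q+1}`. On `E_1` multiplication by two is the norm, which factors through `M ⊗ M`, so `H_q(E_1)`
is killed by two.

For (ii), `λ(m) ↦ m ⊗ m` is injective on free modules because quadratic maps out of them come from
bilinear maps, and its image is `E_1` because every symmetric tensor is `u ⊗ u` plus a norm.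

The homological argument is carried out for a `TateTower`; `N_ε` and `M/2` are replaced by relations
between chains, and degrees are shifted so that index `p` stands for `q = p - 1`. -/

/-- A sequence of chain complexes `C n` and of compatible maps `C n i → C (n + 1) (i + 1)`. -/
structure Tower where
  C : ℕ → ℕ → Type
  grp (n i : ℕ) : AddCommGroup (C n i)
  d (n i : ℕ) : C n (i + 1) →+ C n i
  s (n i : ℕ) : C n i →+ C (n + 1) (i + 1)
  d_d (n i : ℕ) (x : C n (i + 2)) : d n i (d n (i + 1) x) = 0
  d_s (n i : ℕ) (x : C n (i + 1)) : d (n + 1) (i + 1) (s n (i + 1) x) = s n i (d n i x)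

attribute [instance] Tower.grp

namespace Tower

variable (U : Tower)

/-- Cycles modulo two. -/
def CycleTwo {n i : ℕ} (u : U.C n (i + 1)) : Prop := ∃ t, U.d n i u = 2 • t

/-- Boundaries modulo two. -/
def BoundaryTwo {n i : ℕ} (u : U.C n (i + 1)) : Prop :=
  ∃ v t, u = U.d n (i + 1) v + 2 • t

end Tower

/-- A tower `V` with an involution whose Tate cohomology groups are all identified, through the
relations `rel`, with a tower `U` modulo two. The models are `V = X ⊗ X` and `U = X` for the
suspensions `X` of a simplicial module. -/
structure TateTower where
  V : Tower
  U : Tower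
  swap (n i : ℕ) : V.C n i →+ V.C n i
  swap_swap (n i : ℕ) (x : V.C n i) : swap n i (swap n i x) = x
  swap_d (n i : ℕ) (x : V.C n (i + 1)) : swap n i (V.d n i x) = V.d n i (swap n (i + 1) x)
  swap_s (n i : ℕ) (x : V.C n i) : swap (n + 1) (i + 1) (V.s n i x) = V.s n i (swap n i x)
  rel (ε : ℤˣ) (n i : ℕ) : AddSubgroup (V.C n i × U.C n i)
  rel_d {ε : ℤˣ} {n i : ℕ} {y u} (h : (y, u) ∈ rel ε n (i + 1)) :
    (V.d n i y, U.d n i u) ∈ rel ε n i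
  rel_s {ε : ℤˣ} {n i : ℕ} {y u} (h : (y, u) ∈ rel ε n i) :
    (V.s n i y, U.s n i u) ∈ rel ε (n + 1) (i + 1)
  swap_eq_of_rel {ε : ℤˣ} {n i : ℕ} {y u} (h : (y, u) ∈ rel ε n i) : swap n i y = ε • y
  exists_rel_left {ε : ℤˣ} {n i : ℕ} {y} (h : swap n i y = ε • y) : ∃ u, (y, u) ∈ rel ε n i
  exists_rel_right (ε : ℤˣ) {n i : ℕ} (u) : ∃ y, (y, u) ∈ rel ε n i
  norm_rel (ε : ℤˣ) {n i : ℕ} (w : V.C n i) : (w + ε • swap n i w, 0) ∈ rel ε n i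
  eq_two_of_rel_zero {ε : ℤˣ} {n i : ℕ} {u} (h : (0, u) ∈ rel ε n i) : ∃ t, u = 2 • t
  eq_norm_of_rel_two {ε : ℤˣ} {n i : ℕ} {y t} (h : (y, 2 • t) ∈ rel ε n i) :
    ∃ w, y = w + ε • swap n i w
  -- Surjectivity of the homology of the eigenspaces onto homology modulo two, already before
  -- stabilisation.
  exists_cycle_rel (ε : ℤˣ) {n i : ℕ} {u : U.C n (i + 1)} (h : U.CycleTwo u) :
    ∃ y u', (y, u') ∈ rel ε n (i + 1) ∧ V.d n i y = 0 ∧ U.BoundaryTwo (u - u')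
  exists_s_eq_d {n i : ℕ} {z : V.C n (i + 1)} (h : V.d n i z = 0) :
    ∃ v, V.s n (i + 1) z = V.d (n + 1) (i + 2) v
  -- The remaining conditions on `U` say that suspension is injective on homology modulo two, that
  -- this homology vanishes below the connectivity, has at most one nonzero class in each degree,
  -- and has one in each degree from two on when `n = 0`.
  boundaryTwo_of_s {n i : ℕ} {u : U.C n (i + 1)} (h : U.CycleTwo u)
    (h' : U.BoundaryTwo (U.s n (i + 1) u)) : U.BoundaryTwo u
  boundaryTwo_of_le {n i : ℕ} (hi : i ≤ n) {u : U.C n (i + 1)} (h : U.CycleTwo u) :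
    U.BoundaryTwo u
  boundaryTwo_sub {n i : ℕ} {u u' : U.C n (i + 1)} (h : U.CycleTwo u) (h' : U.CycleTwo u')
    (hu : ¬ U.BoundaryTwo u) (hu' : ¬ U.BoundaryTwo u') : U.BoundaryTwo (u - u')
  exists_not_boundaryTwo (q : ℕ) : ∃ u : U.C 0 (q + 2), U.CycleTwo u ∧ ¬ U.BoundaryTwo u

/-! ### Eigenspaces of the involution and cycles that die stably -/

namespace TateTower

variable (S : TateTower)

/-- The norm map. -/
def norm (ε : ℤˣ) (n i : ℕ) : S.V.C n i →+ S.V.C n i :=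
  AddMonoidHom.id _ + (DistribSMul.toAddMonoidHom _ ε).comp (S.swap n i)

lemma norm_apply (ε : ℤˣ) {n i : ℕ} (w : S.V.C n i) :
    S.norm ε n i w = w + ε • S.swap n i w := rfl

/-- The elements on which the involution acts by `ε`. -/
def eigen (ε : ℤˣ) (n i : ℕ) : AddSubgroup (S.V.C n i) :=
  (S.swap n i - DistribSMul.toAddMonoidHom _ ε).ker

variable {S}

lemma mem_eigen {ε : ℤˣ} {n i : ℕ} {x : S.V.C n i} :
    x ∈ S.eigen ε n i ↔ S.swap n i x = ε • x := by
  simp [eigen, AddMonoidHom.mem_ker, sub_eq_zero]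

lemma map_units_smul {A B : Type*} [AddCommGroup A] [AddCommGroup B] (f : A →+ B) (ε : ℤˣ)
    (x : A) : f (ε • x) = ε • f x := by
  rw [Units.smul_def, map_zsmul, Units.smul_def]

lemma units_smul_smul {A : Type*} [AddCommGroup A] (ε : ℤˣ) (x : A) : ε • ε • x = x := by
  rw [smul_smul, Int.units_mul_self, one_smul]

lemma norm_mem (ε : ℤˣ) {n i : ℕ} (w : S.V.C n i) : S.norm ε n i w ∈ S.eigen ε n i := by
  rw [mem_eigen, norm_apply, map_add, map_units_smul, S.swap_swap, smul_add, units_smul_smul,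
    add_comm]

lemma norm_eq_zero {ε : ℤˣ} {n i : ℕ} {w : S.V.C n i} :
    S.norm ε n i w = 0 ↔ w ∈ S.eigen (-ε) n i := by
  rw [mem_eigen, norm_apply, Units.neg_smul, add_comm, add_eq_zero_iff_eq_neg]
  constructor
  · intro h
    rw [← units_smul_smul ε (S.swap n i w), h, smul_neg]
  · intro h
    rw [h, smul_neg, units_smul_smul]

lemma d_norm (ε : ℤˣ) {n i : ℕ} (w : S.V.C n (i + 1)) :
    S.V.d n i (S.norm ε n (i + 1) w) = S.norm ε n i (S.V.d n i w) := by
  rw [norm_apply, norm_apply, map_add, map_units_smul, S.swap_d]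

lemma s_norm (ε : ℤˣ) {n i : ℕ} (w : S.V.C n i) :
    S.V.s n i (S.norm ε n i w) = S.norm ε (n + 1) (i + 1) (S.V.s n i w) := by
  rw [norm_apply, norm_apply, map_add, map_units_smul, S.swap_s]

lemma s_mem {ε : ℤˣ} {n i : ℕ} {w : S.V.C n i} (hw : w ∈ S.eigen ε n i) :
    S.V.s n i w ∈ S.eigen ε (n + 1) (i + 1) := by
  rw [mem_eigen] at *
  rw [S.swap_s, hw, map_units_smul]

variable (S) in
/-- The cycles which become boundaries after a number of suspensions. -/
inductive Dies (ε : ℤˣ) : ∀ n i : ℕ, S.V.C n (i + 1) → Prop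
  | bd (n i : ℕ) (v : S.V.C n (i + 2)) (hv : v ∈ S.eigen ε n (i + 2)) :
      Dies ε n i (S.V.d n (i + 1) v)
  | step (n i : ℕ) (x : S.V.C n (i + 1)) (h : Dies ε (n + 1) (i + 1) (S.V.s n (i + 1) x)) :
      Dies ε n i x

lemma Dies.add_boundary {ε : ℤˣ} {n i : ℕ} {x : S.V.C n (i + 1)} (h : S.Dies ε n i x)
    {v : S.V.C n (i + 2)} (hv : v ∈ S.eigen ε n (i + 2)) :
    S.Dies ε n i (S.V.d n (i + 1) v + x) := by
  induction h with
  | bd n i v' hv' =>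
    rw [← map_add]
    exact .bd _ _ _ (add_mem hv hv')
  | step n i x h ih =>
    refine .step _ _ _ ?_
    rw [map_add, ← S.V.d_s]
    exact ih (s_mem hv)

/-- The connecting map from the class of `d w` to that of the norm of `w` is well defined. If `d w =
d t` with `t` in the `-ε`-eigenspace, then `w - t` is a cycle of `V` with the norm of `w`. Its
suspension bounds some `v` in `V`, and the norm of `v` bounds inside the `ε`-eigenspace. -/
lemma dies_norm_of_dies_d {ε : ℤˣ} {n i : ℕ} {x : S.V.C n (i + 1)} (h : S.Dies (-ε) n i x)
    (w : S.V.C n (i + 2)) (hw : S.V.d n (i + 1) w = x) :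
    S.Dies ε n (i + 1) (S.norm ε n (i + 2) w) := by
  induction h with
  | bd n i t ht =>
    have hd : S.V.d n (i + 1) (w - t) = 0 := by rw [map_sub, hw, sub_self]
    obtain ⟨v, hv⟩ := S.exists_s_eq_d hd
    have : S.norm ε n (i + 2) w = S.norm ε n (i + 2) (w - t) := by
      rw [map_sub, norm_eq_zero.2 ht, sub_zero]
    refine .step _ _ _ ?_
    rw [this, s_norm, hv, ← d_norm]
    exact .bd _ _ _ (norm_mem _ _)
  | step n i x h ih =>
    refine .step _ _ _ ?_
    rw [s_norm]
    exact ih _ (by rw [S.V.d_s, hw])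

/-- The connecting map is injective; this rests on the surjectivity in `exists_cycle_rel`. The index
`j` and the `HEq` leave the degree free for the induction on `Dies`. -/
lemma dies_d_of_dies_norm {ε : ℤˣ} {n j : ℕ} {x : S.V.C n (j + 1)} (h : S.Dies ε n j x)
    (i : ℕ) (hj : i + 1 = j) (w : S.V.C n (i + 2)) (hw : HEq (S.norm ε n (i + 2) w) x) :
    S.Dies (-ε) n i (S.V.d n (i + 1) w) := by
  induction h generalizing i with
  | bd n j y hy =>
    subst hj
    replace hw := eq_of_heq hw
    obtain ⟨u, hu⟩ := S.exists_rel_left (mem_eigen.1 hy)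
    -- Since `d y` is a norm, its class `d u` is even, so `u` is a cycle modulo two.
    have hu' := S.rel_d hu
    rw [← hw] at hu'
    obtain ⟨t, ht⟩ := S.eq_two_of_rel_zero (by
      have := sub_mem hu' (S.norm_rel ε w)
      rwa [norm_apply, Prod.mk_sub_mk, sub_self, sub_zero] at this)
    -- Subtracting from `y` a cycle `y'` with a class homologous to `u`, and then a boundary `d y₁`,
    -- leaves an element whose class is even, hence the norm of some `w'`.
    obtain ⟨y', u', hyu', hy', v, t', huv⟩ := S.exists_cycle_rel ε ⟨t, ht⟩
    obtain ⟨y₁, hy₁⟩ := S.exists_rel_right ε v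
    have h₂ := sub_mem (sub_mem hu hyu') (S.rel_d hy₁)
    rw [Prod.mk_sub_mk, Prod.mk_sub_mk, huv, add_sub_cancel_left] at h₂
    obtain ⟨w', hw'⟩ := S.eq_norm_of_rel_two h₂
    -- Taking boundaries, the norms of `w` and of `d w'` agree. So `w - d w'`, which has the same
    -- boundary as `w`, lies in the kernel of the norm, the `-ε`-eigenspace.
    have h₃ := congrArg (S.V.d n (i + 1 + 1)) hw'
    rw [map_sub, map_sub, hy', S.V.d_d, sub_zero, sub_zero, ← norm_apply, d_norm, ← hw,
      ← sub_eq_zero, ← map_sub, norm_eq_zero] at h₃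
    have h₄ : S.V.d n (i + 1) w = S.V.d n (i + 1) (w - S.V.d n (i + 2) w') := by
      rw [map_sub, S.V.d_d, sub_zero]
    rw [h₄]
    exact .bd _ _ _ h₃
  | step n j x h ih =>
    subst hj
    refine .step _ _ _ ?_
    rw [← S.V.d_s]
    exact ih _ rfl _ (heq_of_eq (by rw [← s_norm, eq_of_heq hw]))

/-- If the class modulo two of a cycle is trivial, the cycle is a norm up to a boundary. -/
lemma exists_norm {ε : ℤˣ} {n i : ℕ} {x : S.V.C n (i + 2)} {u : S.U.C n (i + 2)}
    (h : (x, u) ∈ S.rel ε n (i + 2)) (hx : S.V.d n (i + 1) x = 0) (hu : S.U.BoundaryTwo u) :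
    ∃ v w, v ∈ S.eigen ε n (i + 3) ∧ S.V.d n (i + 1) w ∈ S.eigen (-ε) n (i + 1) ∧
      x = S.V.d n (i + 2) v + S.norm ε n (i + 2) w := by
  obtain ⟨v, t, rfl⟩ := hu
  obtain ⟨y₁, hy₁⟩ := S.exists_rel_right ε v
  have h₂ := sub_mem h (S.rel_d hy₁)
  rw [Prod.mk_sub_mk, add_sub_cancel_left] at h₂
  obtain ⟨w, hw⟩ := S.eq_norm_of_rel_two h₂
  refine ⟨y₁, w, mem_eigen.2 (S.swap_eq_of_rel hy₁), ?_, eq_add_of_sub_eq' hw⟩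
  rw [← norm_eq_zero, ← d_norm, norm_apply, ← hw, map_sub, hx, S.V.d_d, sub_zero]

lemma cycleTwo_of_rel {ε : ℤˣ} {n i : ℕ} {x : S.V.C n (i + 1)} {u : S.U.C n (i + 1)}
    (h : (x, u) ∈ S.rel ε n (i + 1)) (hx : S.V.d n i x = 0) : S.U.CycleTwo u := by
  have := S.rel_d h
  rw [hx] at this
  exact S.eq_two_of_rel_zero this

/-- Below the connectivity homology modulo two vanishes, so the cycle is a norm of some `w` up to a
boundary. Now `d w` is a cycle of the opposite sign one degree lower; it dies by induction, and so
does the norm. The induction starts at the zero group in degree one. -/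
lemma dies_of_le (hV : ∀ n, Subsingleton (S.V.C n 1)) {ε : ℤˣ} {n i : ℕ} (hi : i ≤ n)
    {x : S.V.C n (i + 1)} (hx : x ∈ S.eigen ε n (i + 1)) (hdx : S.V.d n i x = 0) :
    S.Dies ε n i x := by
  induction i generalizing ε with
  | zero =>
    have := hV n
    rw [Subsingleton.elim x (S.V.d n 1 0)]
    exact .bd _ _ _ (zero_mem _)
  | succ i ih =>
    obtain ⟨u, hu⟩ := S.exists_rel_left (mem_eigen.1 hx)
    obtain ⟨v, w, hv, hw, rfl⟩ :=
      exists_norm hu hdx (S.boundaryTwo_of_le hi (cycleTwo_of_rel hu hdx))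
    exact (dies_norm_of_dies_d (ih (by omega) hw (S.V.d_d _ _ _)) w rfl).add_boundary hv

variable (S) in
/-- The cycles on which the involution acts by `ε`. -/
def cycles (ε : ℤˣ) (n i : ℕ) : AddSubgroup (S.V.C n (i + 1)) :=
  S.eigen ε n (i + 1) ⊓ (S.V.d n i).ker

lemma s_mem_cycles {ε : ℤˣ} {n i : ℕ} {x : S.V.C n (i + 1)} (hx : x ∈ S.cycles ε n i) :
    S.V.s n (i + 1) x ∈ S.cycles ε (n + 1) (i + 1) := by
  refine ⟨s_mem hx.1, ?_⟩
  exact (S.V.d_s _ _ _).trans ((congrArg _ hx.2).trans (map_zero _))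

variable (S) in
/-- `G` is the stable homology group of the `ε`-eigenspaces: the colimit over `n` of the homology
groups in degree `p + n + 1`. -/
structure StableHomology (ε : ℤˣ) (p : ℕ) (G : Type) [AddCommGroup G] where
  -- Keeping `i` as a variable with a proof of `i = p + n` avoids casts between stages.
  κ (n i : ℕ) (h : i = p + n) : S.cycles ε n i →+ G
  κ_s (n i : ℕ) (h : i = p + n) (z : S.cycles ε n i) :
    κ (n + 1) (i + 1) (by omega) ⟨_, s_mem_cycles z.2⟩ = κ n i h z
  exists_κ (g : G) : ∃ n i h z, κ n i h z = g
  κ_eq_zero (n i : ℕ) (h : i = p + n) (z : S.cycles ε n i) : κ n i h z = 0 ↔ S.Dies ε n i z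

namespace StableHomology

variable {ε : ℤˣ} {p : ℕ} {G : Type} [AddCommGroup G] (H : S.StableHomology ε p G)

lemma exists_κ_of_le (g : G) : ∃ n₀, ∀ n ≥ n₀, ∃ i h z, H.κ n i h z = g := by
  obtain ⟨n₀, i, h, z, rfl⟩ := H.exists_κ g
  refine ⟨n₀, fun n hn => ?_⟩
  induction n, hn using Nat.le_induction with
  | base => exact ⟨i, h, z, rfl⟩
  | succ n hn ih =>
    obtain ⟨i', h', z', hz'⟩ := ih
    exact ⟨i' + 1, by omega, _, (H.κ_s n i' h' z').trans hz'⟩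

lemma κ_congr {n i : ℕ} (h h' : i = p + n) {z z' : S.cycles ε n i} (hz : z.1 = z'.1) :
    H.κ n i h z = H.κ n i h' z' := by
  rw [Subtype.ext hz]

end StableHomology

lemma norm_mem_cycles {ε : ℤˣ} {n i : ℕ} {w : S.V.C n (i + 2)}
    (hw : S.V.d n (i + 1) w ∈ S.eigen (-ε) n (i + 1)) :
    S.norm ε n (i + 2) w ∈ S.cycles ε n (i + 1) :=
  ⟨norm_mem _ _, (d_norm _ _).trans (norm_eq_zero.2 hw)⟩

lemma d_mem_cycles {ε : ℤˣ} {n i : ℕ} {w : S.V.C n (i + 2)}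
    (hw : S.V.d n (i + 1) w ∈ S.eigen ε n (i + 1)) :
    S.V.d n (i + 1) w ∈ S.cycles ε n i :=
  ⟨hw, S.V.d_d _ _ _⟩

/-! ### The connecting homomorphism of the norm, and its image -/

section Step

variable {ε : ℤˣ} {p : ℕ} {A B : Type} [AddCommGroup A] [AddCommGroup B]
  (HA : S.StableHomology (-ε) p A) (HB : S.StableHomology ε (p + 1) B)

/-- The classes of `d w` and of the norm of `w` are connected. -/
def Connected (n : ℕ) (a : A) (b : B) : Prop :=
  ∃ (i : ℕ) (h : i = p + n) (w : S.V.C n (i + 2))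
    (hw : S.V.d n (i + 1) w ∈ S.eigen (-ε) n (i + 1)),
      HA.κ n i h ⟨_, d_mem_cycles hw⟩ = a ∧
        HB.κ n (i + 1) (by omega) ⟨_, norm_mem_cycles hw⟩ = b

variable {HA HB}

lemma Connected.succ {n : ℕ} {a : A} {b : B} (h : Connected HA HB n a b) :
    Connected HA HB (n + 1) a b := by
  obtain ⟨i, hi, w, hw, rfl, rfl⟩ := h
  have hw' : S.V.d (n + 1) (i + 2) (S.V.s n (i + 2) w) ∈ S.eigen (-ε) (n + 1) (i + 2) := by
    rw [S.V.d_s]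
    exact s_mem hw
  refine ⟨i + 1, by omega, S.V.s n _ w, hw', ?_, ?_⟩
  · refine (HA.κ_congr _ _ ?_).trans (HA.κ_s n i hi _)
    exact S.V.d_s n (i + 1) w
  · refine (HB.κ_congr _ _ ?_).trans (HB.κ_s n (i + 1) (by omega) _)
    exact (s_norm ε w).symm

lemma Connected.of_le {n m : ℕ} (hnm : n ≤ m) {a : A} {b : B} (h : Connected HA HB n a b) :
    Connected HA HB m a b := by
  induction m, hnm using Nat.le_induction with
  | base => exact h
  | succ m _ ih => exact ih.succ

variable (HA HB) in
/-- The graph of the map induced by the connecting homomorphism of the norm. -/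
def graph : AddSubgroup (A × B) where
  carrier := {x | ∃ n, Connected HA HB n x.1 x.2}
  zero_mem' := by
    refine ⟨0, p, rfl, 0, by rw [map_zero]; exact zero_mem _, ?_, ?_⟩
    · exact (HA.κ_congr _ rfl (map_zero _)).trans (map_zero _)
    · exact (HB.κ_congr _ rfl (map_zero _)).trans (map_zero _)
  add_mem' := by
    rintro ⟨a, b⟩ ⟨a', b'⟩ ⟨n, h⟩ ⟨n', h'⟩
    obtain ⟨i, hi, w, hw, rfl, rfl⟩ := h.of_le (le_max_left n n')
    obtain ⟨i', hi', w', hw', rfl, rfl⟩ := h'.of_le (le_max_right n n')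
    obtain rfl : i = i' := hi.trans hi'.symm
    refine ⟨_, i, hi, w + w', by rw [map_add]; exact add_mem hw hw', ?_, ?_⟩
    · exact (HA.κ_congr _ _ (map_add _ _ _)).trans (map_add (HA.κ _ _ _) _ _)
    · exact (HB.κ_congr _ _ (map_add _ _ _)).trans (map_add (HB.κ _ _ _) _ _)
  neg_mem' := by
    rintro ⟨a, b⟩ ⟨n, i, hi, w, hw, rfl, rfl⟩
    refine ⟨_, i, hi, -w, by rw [map_neg]; exact neg_mem hw, ?_, ?_⟩
    · exact (HA.κ_congr _ _ (map_neg _ _)).trans (map_neg (HA.κ _ _ _) _)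
    · exact (HB.κ_congr _ _ (map_neg _ _)).trans (map_neg (HB.κ _ _ _) _)

/-- The suspension of a cycle is a boundary `d v` in `V`; the norm of `v` represents its partner. -/
lemma graph_fst_surjective (a : A) : ∃ b, (a, b) ∈ graph HA HB := by
  obtain ⟨n, i, hi, z, rfl⟩ := HA.exists_κ a
  obtain ⟨v, hv⟩ := S.exists_s_eq_d z.2.2
  have hv' : S.V.d (n + 1) (i + 2) v ∈ S.eigen (-ε) (n + 1) (i + 2) := by
    rw [← hv]
    exact s_mem z.2.1
  refine ⟨_, n + 1, i + 1, by omega, v, hv', ?_, rfl⟩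
  exact (HA.κ_congr _ (by omega) hv.symm).trans (HA.κ_s n i hi z)

lemma eq_zero_of_mem_graph_left {a : A} (h : (a, 0) ∈ graph HA HB) : a = 0 := by
  obtain ⟨n, i, hi, w, hw, rfl, h⟩ := h
  rw [HB.κ_eq_zero] at h
  rw [HA.κ_eq_zero]
  exact dies_d_of_dies_norm h i rfl w HEq.rfl

lemma eq_zero_of_mem_graph_right {b : B} (h : (0, b) ∈ graph HA HB) : b = 0 := by
  obtain ⟨n, i, hi, w, hw, h, rfl⟩ := h
  rw [HA.κ_eq_zero] at h
  rw [HB.κ_eq_zero]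
  exact dies_norm_of_dies_d h w rfl

/-- One half of exactness: the kernel of the map to homology modulo two is contained in the image of
the connecting map. -/
lemma mem_graph_of_boundaryTwo {n i : ℕ} (h : i + 1 = p + 1 + n) (z : S.cycles ε n (i + 1))
    {u : S.U.C n (i + 2)} (hu : (z.1, u) ∈ S.rel ε n (i + 2)) (hb : S.U.BoundaryTwo u) :
    ∃ a, (a, HB.κ n (i + 1) h z) ∈ graph HA HB := by
  obtain ⟨v, w, hv, hw, hz⟩ := exists_norm hu z.2.2 hb
  refine ⟨_, n, i, by omega, w, hw, rfl, ?_⟩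
  rw [eq_comm, ← sub_eq_zero, ← map_sub, HB.κ_eq_zero, AddSubgroup.coe_sub, hz,
    add_sub_cancel_right]
  exact .bd _ _ _ hv

/-- The map to homology modulo two respects stable boundaries: for `d v` the class of `v` provides
the bounding chain, and injectivity of suspension modulo two undoes each suspension. -/
lemma boundaryTwo_of_dies {n i : ℕ} {x : S.V.C n (i + 1)} (h : S.Dies ε n i x)
    (hx : x ∈ S.cycles ε n i)
    {u : S.U.C n (i + 1)} (hu : (x, u) ∈ S.rel ε n (i + 1)) : S.U.BoundaryTwo u := by
  induction h with
  | bd n i v hv =>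
    obtain ⟨v', hv'⟩ := S.exists_rel_left (mem_eigen.1 hv)
    have := sub_mem hu (S.rel_d hv')
    rw [Prod.mk_sub_mk, sub_self] at this
    obtain ⟨t, ht⟩ := S.eq_two_of_rel_zero this
    exact ⟨v', t, eq_add_of_sub_eq' ht⟩
  | step n i x h ih =>
    exact S.boundaryTwo_of_s (cycleTwo_of_rel hu hx.2) (ih (s_mem_cycles hx) (S.rel_s hu))

/-- A class is trivial modulo two when it is represented by a cycle which is so. -/
lemma boundaryTwo_of_mem_graph {n i : ℕ} (h : i + 1 = p + 1 + n) (z : S.cycles ε n (i + 1))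
    {u : S.U.C n (i + 2)} (hu : (z.1, u) ∈ S.rel ε n (i + 2)) {a : A}
    (ha : (a, HB.κ n (i + 1) h z) ∈ graph HA HB) : S.U.BoundaryTwo u := by
  obtain ⟨m, hm⟩ := ha
  -- The two classes are compared at a common later stage; `u` is carried along, and the triviality
  -- of its suspension comes back to `u`.
  suffices H : ∀ k ≥ n, ∃ (j : ℕ) (hj : j + 1 = p + 1 + k) (z' : S.cycles ε k (j + 1))
      (u' : S.U.C k (j + 2)), (z'.1, u') ∈ S.rel ε k (j + 2) ∧
        HB.κ k (j + 1) hj z' = HB.κ n (i + 1) h z ∧ (S.U.BoundaryTwo u' → S.U.BoundaryTwo u) by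
    obtain ⟨j, hj, z', u', hu', hz', hb⟩ := H _ (le_max_right m n)
    obtain ⟨j', hj', w, hw, -, hb'⟩ := hm.of_le (le_max_left m n)
    obtain rfl : j = j' := by omega
    refine hb (boundaryTwo_of_dies (x := z'.1 - S.norm ε _ (j + 2) w) ?_
      (sub_mem z'.2 (norm_mem_cycles hw)) (u := u') ?_)
    · refine (HB.κ_eq_zero _ _ hj (z' - ⟨_, norm_mem_cycles hw⟩)).1 ?_
      rw [map_sub, hz', hb', sub_self]
    · have := sub_mem hu' (S.norm_rel ε w)
      rwa [Prod.mk_sub_mk, sub_zero] at this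
  intro k hk
  induction k, hk using Nat.le_induction with
  | base => exact ⟨i, h, z, u, hu, rfl, id⟩
  | succ k hk ih =>
    obtain ⟨j, hj, z', u', hu', hz', hb⟩ := ih
    exact ⟨j + 1, by omega, ⟨_, s_mem_cycles z'.2⟩, _, S.rel_s hu',
      (HB.κ_s k (j + 1) hj z').trans hz',
      fun h => hb (S.boundaryTwo_of_s (cycleTwo_of_rel hu' z'.2.2) h)⟩

/-- The graph is that of an injective homomorphism `A → B`. Its image is the kernel of the map onto
the homology modulo two, which has two elements, so it has index two. -/
lemma card_eq_two_mul (HA : S.StableHomology (-ε) p A) (HB : S.StableHomology ε (p + 1) B)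
    (hε : ∃ u : S.U.C 0 (p + 2), S.U.CycleTwo u ∧ ¬ S.U.BoundaryTwo u) :
    Nat.card B = 2 * Nat.card A := by
  set R := graph HA HB
  have h₁ : Function.Bijective fun x : R => x.1.1 := by
    refine ⟨fun x y hxy => ?_, fun a => ?_⟩
    · have h := sub_mem x.2 y.2
      rw [show x.1 - y.1 = (0, x.1.2 - y.1.2) from Prod.ext (sub_eq_zero.2 hxy) rfl] at h
      exact Subtype.ext (Prod.ext hxy (sub_eq_zero.1 (eq_zero_of_mem_graph_right h)))
    · obtain ⟨b, hb⟩ := graph_fst_surjective (HB := HB) a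
      exact ⟨⟨_, hb⟩, rfl⟩
  have h₂ : Function.Injective ((AddMonoidHom.snd A B).comp R.subtype) := by
    refine (injective_iff_map_eq_zero _).2 fun x hx => ?_
    have h := x.2
    rw [show x.1 = (x.1.1, 0) from Prod.ext rfl hx] at h
    exact Subtype.ext (Prod.ext (eq_zero_of_mem_graph_left h) hx)
  have hR {b : B} : b ∈ ((AddMonoidHom.snd A B).comp R.subtype).range ↔ ∃ a, (a, b) ∈ R :=
    ⟨by rintro ⟨x, rfl⟩; exact ⟨_, x.2⟩, fun ⟨a, h⟩ => ⟨⟨_, h⟩, rfl⟩⟩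
  have h₃ : ((AddMonoidHom.snd A B).comp R.subtype).range.index = 2 := by
    rw [AddSubgroup.index_eq_two_iff_exists_notMem_and]
    obtain ⟨u, hu, hu'⟩ := hε
    obtain ⟨y, u', hyu, hy, hb⟩ := S.exists_cycle_rel ε hu
    have hu'' : ¬ S.U.BoundaryTwo u' := fun h => hu' (by
      obtain ⟨v, t, hv⟩ := hb
      obtain ⟨v', t', rfl⟩ := h
      exact ⟨v + v', t + t', by rw [map_add, smul_add, eq_add_of_sub_eq hv]; abel⟩)
    let z : S.cycles ε 0 (p + 1) := ⟨y, mem_eigen.2 (S.swap_eq_of_rel hyu), hy⟩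
    -- The sign turns the sum in the criterion for index two into a difference of classes.
    have hz : -HB.κ 0 (p + 1) rfl z ∉ ((AddMonoidHom.snd A B).comp R.subtype).range := by
      rw [neg_mem_iff, hR]
      rintro ⟨a, ha⟩
      exact hu'' (boundaryTwo_of_mem_graph (n := 0) (i := p) rfl z hyu ha)
    refine ⟨_, hz, fun b => ?_⟩
    obtain ⟨n₁, h₁⟩ := HB.exists_κ_of_le b
    obtain ⟨n₂, h₂⟩ := HB.exists_κ_of_le (HB.κ 0 (p + 1) rfl z)
    obtain ⟨i, hi, x, hx⟩ := h₁ _ (le_max_left n₁ n₂)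
    obtain ⟨i', hi', x', hx'⟩ := h₂ _ (le_max_right n₁ n₂)
    obtain rfl : i = i' := hi.trans hi'.symm
    obtain ⟨j, rfl⟩ : ∃ j, i = j + 1 := ⟨i - 1, by omega⟩
    obtain ⟨v, hv⟩ := S.exists_rel_left (mem_eigen.1 x.2.1)
    obtain ⟨v', hv'⟩ := S.exists_rel_left (mem_eigen.1 x'.2.1)
    by_cases hbv : S.U.BoundaryTwo v
    · right
      rw [hR, ← hx]
      exact mem_graph_of_boundaryTwo hi x hv hbv
    -- Two classes that are nonzero modulo two coincide modulo two.
    · left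
      have hbv' : ¬ S.U.BoundaryTwo v' := fun h => by
        rw [neg_mem_iff, hR, ← hx'] at hz
        exact hz (mem_graph_of_boundaryTwo hi' x' hv' h)
      rw [hR, ← sub_eq_add_neg, ← hx, ← hx', ← map_sub]
      refine mem_graph_of_boundaryTwo hi (x - x') (u := v - v') (sub_mem hv hv') ?_
      exact S.boundaryTwo_sub (cycleTwo_of_rel hv x.2.2) (cycleTwo_of_rel hv' x'.2.2) hbv hbv'
  rw [← AddSubgroup.card_mul_index ((AddMonoidHom.snd A B).comp R.subtype).range, h₃, mul_comm,
    Nat.card_congr (AddMonoidHom.ofInjective h₂).toEquiv.symm,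
    Nat.card_congr (Equiv.ofBijective _ h₁)]

end Step

variable (S) in
/-- The boundaries among the cycles. -/
def boundaries (ε : ℤˣ) (n i : ℕ) : AddSubgroup (S.cycles ε n i) :=
  ((S.eigen ε n (i + 2)).map (S.V.d n (i + 1))).comap (S.cycles ε n i).subtype

variable (S) in
/-- The suspension of cycles. -/
def sCycles (ε : ℤˣ) (n i : ℕ) : S.cycles ε n i →+ S.cycles ε (n + 1) (i + 1) :=
  ((S.V.s n (i + 1)).comp (S.cycles ε n i).subtype).codRestrict _ fun z => s_mem_cycles z.2

variable (S) in
/-- The suspension map of homology groups. -/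
def sHomology (ε : ℤˣ) (n i : ℕ) : AddCommGrpCat.of (S.cycles ε n i ⧸ S.boundaries ε n i) ⟶
    AddCommGrpCat.of (S.cycles ε (n + 1) (i + 1) ⧸ S.boundaries ε (n + 1) (i + 1)) :=
  AddCommGrpCat.ofHom (QuotientAddGroup.map _ _ (S.sCycles ε n i) (by
    rintro ⟨_, hz⟩ ⟨v, hv, rfl⟩
    exact ⟨_, s_mem hv, S.V.d_s _ _ _⟩))

end TateTower

/-! ### Elements of sequential colimits of abelian groups -/

section Sequence

open Limits

variable {A : ℕ → AddCommGrpCat.{0}} (f : ∀ n, A n ⟶ A (n + 1))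

lemma ofSequence_ι_succ (n : ℕ) (a : A n) :
    (colimit.ι (Functor.ofSequence f) (n + 1)).hom ((f n).hom a) =
      (colimit.ι (Functor.ofSequence f) n).hom a := by
  have h := colimit.w (Functor.ofSequence f) (homOfLE (Nat.le_add_right n 1))
  rw [Functor.ofSequence_map_homOfLE_succ] at h
  exact congrArg (fun g => g.hom a) h

lemma exists_ofSequence_ι (x : (colimit (Functor.ofSequence f) : AddCommGrpCat.{0})) :
    ∃ (n : ℕ) (a : A n), (colimit.ι (Functor.ofSequence f) n).hom a = x :=
  Concrete.colimit_exists_rep (Functor.ofSequence f) x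

/-- An element of a sequential colimit vanishes only if it does so at a finite stage. -/
lemma of_ofSequence_ι_eq_zero {P : ∀ n, A n → Prop} (h₀ : ∀ n, P n 0)
    (hs : ∀ n a, P (n + 1) ((f n).hom a) → P n a) {n : ℕ} {a : A n}
    (h : (colimit.ι (Functor.ofSequence f) n).hom a = 0) : P n a := by
  obtain ⟨k, g, g', hk⟩ := Concrete.colimit_exists_of_rep_eq (Functor.ofSequence f) a (0 : A n)
    (h.trans (map_zero _).symm)
  replace hk : ((Functor.ofSequence f).map g).hom a = 0 := hk.trans (map_zero _)
  have hnk := leOfHom g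
  obtain rfl : g = homOfLE hnk := rfl
  clear h
  obtain ⟨m, hm⟩ := Nat.exists_eq_add_of_le hnk
  induction m generalizing n with
  | zero =>
    obtain rfl : k = n := hm
    have : (Functor.ofSequence f).map (homOfLE hnk) = 𝟙 _ := (Functor.ofSequence f).map_id k
    rw [this] at hk
    obtain rfl : a = 0 := hk
    exact h₀ k
  | succ m ih =>
    have hnk' : n + 1 ≤ k := by omega
    have : (Functor.ofSequence f).map (homOfLE hnk) =
        f n ≫ (Functor.ofSequence f).map (homOfLE hnk') :=
      ((Functor.ofSequence f).map_comp (homOfLE (Nat.le_add_right n 1)) (homOfLE hnk')).trans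
        (congrArg (· ≫ _) (Functor.ofSequence_map_homOfLE_succ f n))
    rw [this] at hk
    exact hs n a (ih (a := (f n).hom a) (homOfLE hnk') hnk' hk (by omega))

end Sequence

/-! ### Stable homology as a colimit; its order and exponent -/

namespace TateTower

variable (S : TateTower)

/-- The colimit of the sequence of homology groups. -/
def stableHomologyGroup (ε : ℤˣ) (p : ℕ) : AddCommGrpCat.{0} :=
  Limits.colimit (Functor.ofSequence
    (X := fun n => AddCommGrpCat.of (S.cycles ε n (p + n) ⧸ S.boundaries ε n (p + n)))
    fun n => S.sHomology ε n (p + n))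

variable {S} in
/-- The colimit of a sequence of homology groups is a stable homology group. -/
def StableHomology.ofSequence {ε : ℤˣ} {p : ℕ} {A : ℕ → AddCommGrpCat.{0}}
    (f : ∀ n, A n ⟶ A (n + 1)) (κ : ∀ n i, i = p + n → (S.cycles ε n i →+ A n))
    (κ_s : ∀ n i h z, (f n).hom (κ n i h z) = κ (n + 1) (i + 1) (by omega) ⟨_, s_mem_cycles z.2⟩)
    (surjective : ∀ n i h, Function.Surjective (κ n i h))
    (eq_zero : ∀ n i h z, κ n i h z = 0 ↔ ∃ v ∈ S.eigen ε n (i + 2), S.V.d n (i + 1) v = z.1) :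
    S.StableHomology ε p (Limits.colimit (Functor.ofSequence f) : AddCommGrpCat.{0}) where
  κ n i h := (Limits.colimit.ι (Functor.ofSequence f) n).hom.comp (κ n i h)
  κ_s n i h z :=
    (congrArg _ (κ_s n i h z).symm).trans (ofSequence_ι_succ f n (κ n i h z))
  exists_κ g := by
    obtain ⟨n, a, rfl⟩ := exists_ofSequence_ι f g
    obtain ⟨z, rfl⟩ := surjective n _ rfl a
    exact ⟨n, _, rfl, z, rfl⟩
  κ_eq_zero n i h z := by
    constructor
    · intro hz
      subst h
      -- The property descended along the sequence: every cycle representing the element dies.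
      refine of_ofSequence_ι_eq_zero f (P := fun n a => ∀ z, κ n _ rfl z = a →
        S.Dies ε n (p + n) z) ?_ ?_ hz z rfl
      · intro n z hz
        obtain ⟨v, hv, hz⟩ := (eq_zero _ _ _ z).1 hz
        exact hz ▸ Dies.bd (S := S) n (p + n) v hv
      · rintro n _ h z rfl
        exact .step _ _ _ (h _ (κ_s n _ rfl z).symm)
    · obtain ⟨x, hx⟩ := z
      intro (hd : S.Dies ε n i x)
      induction hd with
      | bd n i v hv =>
        exact (congrArg _ ((eq_zero n i h ⟨_, hx⟩).2 ⟨v, hv, rfl⟩)).trans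
          (map_zero (Limits.colimit.ι (Functor.ofSequence f) n).hom)
      | step n i x _ ih =>
        have := ih (by omega) (s_mem_cycles hx)
        exact ((ofSequence_ι_succ f n (κ n i h ⟨x, hx⟩)).symm.trans
          (congrArg _ (κ_s n i h ⟨x, hx⟩))).trans this

/-- The colimit of the sequence of homology groups is a stable homology group. -/
def stableHomology (ε : ℤˣ) (p : ℕ) : S.StableHomology ε p (S.stableHomologyGroup ε p) :=
  .ofSequence _ (fun _ _ h => h ▸ QuotientAddGroup.mk' _)
    (fun _ _ h _ => by subst h; rfl)
    (fun _ _ h => by subst h; exact QuotientAddGroup.mk_surjective)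
    (fun _ _ h z => by subst h; exact QuotientAddGroup.eq_zero_iff z)

variable {S}

/-- Index zero lies below the connectivity; each further index doubles the order and changes the
sign `ε`, hence the induction over both signs. -/
theorem card_stableHomology (hV : ∀ n, Subsingleton (S.V.C n 1)) {ε : ℤˣ} {p : ℕ} {G : Type}
    [AddCommGroup G] (H : S.StableHomology ε p G) : Nat.card G = 2 ^ p := by
  induction p generalizing ε G with
  | zero =>
    have (g : G) : g = 0 := by
      obtain ⟨n, i, h, z, rfl⟩ := H.exists_κ g
      exact (H.κ_eq_zero n i h z).2 (dies_of_le hV (by omega) z.2.1 z.2.2)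
    have : Unique G := ⟨⟨0⟩, this⟩
    exact Nat.card_unique
  | succ p ih =>
    rw [card_eq_two_mul (S.stableHomology (-ε) p) H (S.exists_not_boundaryTwo p),
      ih (S.stableHomology (-ε) p), pow_succ']

/-- On symmetric tensors `2z` is the norm of `z`. As the suspension of `z` bounds in `V`, its norm
bounds among symmetric tensors. -/
theorem two_smul_stableHomology {p : ℕ} {G : Type} [AddCommGroup G]
    (H : S.StableHomology 1 p G) (g : G) : 2 • g = 0 := by
  obtain ⟨n, i, h, z, rfl⟩ := H.exists_κ g
  have hz : S.norm 1 n (i + 1) z = 2 • z.1 := by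
    rw [norm_apply, mem_eigen.1 z.2.1, one_smul, one_smul, two_smul]
  obtain ⟨v, hv⟩ := S.exists_s_eq_d z.2.2
  rw [← map_nsmul, H.κ_eq_zero]
  refine .step _ _ _ ?_
  rw [AddSubgroup.coe_nsmul, ← hz, s_norm, hv, ← d_norm]
  exact .bd _ _ _ (norm_mem _ _)

/-- The stable homology groups of the fixed points are elementary abelian. -/
theorem nonempty_stableHomology_addEquiv (hV : ∀ n, Subsingleton (S.V.C n 1)) {p : ℕ} {G : Type}
    [AddCommGroup G] (H : S.StableHomology 1 p G) : Nonempty (G ≃+ (Fin p → ZMod 2)) := by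
  let _ : Module (ZMod 2) G := AddCommGroup.zmodModule (two_smul_stableHomology H)
  have hc := card_stableHomology hV H
  have : Finite G := Nat.finite_of_card_ne_zero (by rw [hc]; positivity)
  have hr : Module.finrank (ZMod 2) G = p := by
    have h := Module.natCard_eq_pow_finrank (K := ZMod 2) (V := G)
    rw [hc, Nat.card_zmod] at h
    exact (Nat.pow_right_injective le_rfl h).symm
  exact ⟨(LinearEquiv.ofFinrankEq G (Fin p → ZMod 2)
    (hr.trans (Module.finrank_fin_fun _).symm)).toAddEquiv⟩

end TateTower

open CategoryTheory.Limits AlgebraicTopology Opposite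
open scoped TensorProduct

/-! ### Symmetric and antisymmetric tensors over `ℤ/4` -/

section Tensors

variable {M N : Type} [AddCommGroup M] [Module (ZMod 4) M] [AddCommGroup N] [Module (ZMod 4) N]

lemma four_nsmul_eq_zero (x : M) : 4 • x = 0 := by
  rw [← Nat.cast_smul_eq_nsmul (ZMod 4)]
  exact zero_smul _ x

lemma four_zsmul_eq_zero (x : M) : (4 : ℤ) • x = 0 := by
  rw [← four_nsmul_eq_zero x, ← natCast_zsmul]
  rfl

lemma two_nsmul_tmul_two_nsmul (t : M) : (2 • t) ⊗ₜ[ZMod 4] (2 • t) = 0 := by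
  rw [← four_nsmul_eq_zero (t ⊗ₜ[ZMod 4] t), two_nsmul, TensorProduct.add_tmul,
    TensorProduct.tmul_add]
  abel

/-- The multiple of `u ⊗ u` generating the Tate cohomology. -/
def tateCoeff (ε : ℤˣ) : ℤ := if ε = 1 then 1 else 2

lemma tateCoeff_one : tateCoeff 1 = 1 := rfl

lemma tateCoeff_neg_one : tateCoeff (-1) = 2 := rfl

/-- The interchange of the factors. -/
def interchange (M : Type) [AddCommGroup M] [Module (ZMod 4) M] :
    M ⊗[ZMod 4] M →ₗ[ZMod 4] M ⊗[ZMod 4] M :=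
  (TensorProduct.comm (ZMod 4) M M).toLinearMap

lemma interchange_tmul (x y : M) : interchange M (x ⊗ₜ y) = y ⊗ₜ x := rfl

lemma interchange_interchange (x : M ⊗[ZMod 4] M) : interchange M (interchange M x) = x := by
  induction x with
  | zero => simp
  | tmul x y => rfl
  | add x y hx hy => rw [map_add, map_add, hx, hy]

lemma interchange_map (f : M →ₗ[ZMod 4] N) (x : M ⊗[ZMod 4] M) :
    interchange N (TensorProduct.map f f x) = TensorProduct.map f f (interchange M x) := by
  induction x with
  | zero => simp
  | tmul x y => rfl
  | add x y hx hy => simp only [map_add, hx, hy]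

/-- The norm of a tensor. -/
def tensorNorm (ε : ℤˣ) (w : M ⊗[ZMod 4] M) : M ⊗[ZMod 4] M := w + ε • interchange M w

lemma tensorNorm_add (ε : ℤˣ) (w w' : M ⊗[ZMod 4] M) :
    tensorNorm ε (w + w') = tensorNorm ε w + tensorNorm ε w' := by
  rw [tensorNorm, tensorNorm, tensorNorm, map_add, smul_add]
  abel

lemma tensorNorm_neg (ε : ℤˣ) (w : M ⊗[ZMod 4] M) :
    tensorNorm ε (-w) = - tensorNorm ε w := by
  rw [tensorNorm, tensorNorm, map_neg, smul_neg, neg_add]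

lemma map_tensorNorm (ε : ℤˣ) (f : M →ₗ[ZMod 4] N) (w : M ⊗[ZMod 4] M) :
    TensorProduct.map f f (tensorNorm ε w) = tensorNorm ε (TensorProduct.map f f w) := by
  rw [tensorNorm, tensorNorm, map_add, interchange_map, Units.smul_def, Units.smul_def, map_zsmul]

/-- This makes `u ↦ c (u ⊗ u)` additive modulo norms. For `ε = -1` the tensor is the norm of `2x`,
because `2 = -2` in `ℤ/4`. -/
lemma exists_tensorNorm (ε : ℤˣ) (x : M ⊗[ZMod 4] M) :
    ∃ w, tateCoeff ε • (x + interchange M x) = tensorNorm ε w := by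
  obtain rfl | rfl := Int.units_eq_one_or ε
  · exact ⟨x, by rw [tateCoeff_one, tensorNorm, one_smul, one_smul]⟩
  · refine ⟨(2 : ℤ) • x, ?_⟩
    have h := four_zsmul_eq_zero (interchange M x)
    rw [tateCoeff_neg_one, tensorNorm, smul_add, Units.neg_smul, one_smul, map_zsmul,
      ← sub_eq_zero]
    rw [← h]
    module

lemma add_tmul_add_self (u v : M) :
    (u + v) ⊗ₜ[ZMod 4] (u + v) = u ⊗ₜ u + v ⊗ₜ v + (u ⊗ₜ v + interchange M (u ⊗ₜ v)) := by
  rw [interchange_tmul, TensorProduct.add_tmul, TensorProduct.tmul_add, TensorProduct.tmul_add]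
  abel

variable (M) in
/-- A tensor `y` is related to `u` if it is the sum of the multiple of `u ⊗ u` and of a norm. -/
def tensorRel (ε : ℤˣ) : AddSubgroup ((M ⊗[ZMod 4] M) × M) where
  carrier := {x | ∃ w, x.1 = tateCoeff ε • (x.2 ⊗ₜ x.2) + tensorNorm ε w}
  zero_mem' := ⟨0, by simp [tensorNorm]⟩
  add_mem' := by
    rintro ⟨y, u⟩ ⟨y', u'⟩ ⟨w, hw⟩ ⟨w', hw'⟩
    dsimp only at hw hw'
    subst hw hw'
    obtain ⟨v, hv⟩ := exists_tensorNorm ε (u ⊗ₜ[ZMod 4] u')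
    refine ⟨w + w' - v, ?_⟩
    change _ = tateCoeff ε • ((u + u') ⊗ₜ[ZMod 4] (u + u')) + _
    rw [add_tmul_add_self, smul_add, hv, sub_eq_add_neg, tensorNorm_add, tensorNorm_add,
      tensorNorm_neg, smul_add]
    simp only [Prod.mk_add_mk]
    abel
  neg_mem' := by
    rintro ⟨y, u⟩ ⟨w, hw⟩
    dsimp only at hw
    subst hw
    -- The tensors `c (u ⊗ u)` and `-c (u ⊗ u)` differ by `2c (u ⊗ u)`, a norm by the case `x = u ⊗
    -- u`.
    obtain ⟨v, hv⟩ := exists_tensorNorm ε (u ⊗ₜ[ZMod 4] u)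
    refine ⟨-w - v, ?_⟩
    change - (_ + _) = tateCoeff ε • ((-u) ⊗ₜ[ZMod 4] (-u)) + _
    rw [TensorProduct.neg_tmul, TensorProduct.tmul_neg, neg_neg, sub_eq_add_neg, tensorNorm_add,
      tensorNorm_neg, tensorNorm_neg, ← hv, interchange_tmul, smul_add]
    abel

lemma mem_tensorRel {ε : ℤˣ} {y : M ⊗[ZMod 4] M} {u : M} :
    (y, u) ∈ tensorRel M ε ↔ ∃ w, y = tateCoeff ε • (u ⊗ₜ u) + tensorNorm ε w := Iff.rfl

lemma map_mem_tensorRel (f : M →ₗ[ZMod 4] N) {ε : ℤˣ} {y : M ⊗[ZMod 4] M} {u : M}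
    (h : (y, u) ∈ tensorRel M ε) : (TensorProduct.map f f y, f u) ∈ tensorRel N ε := by
  obtain ⟨w, rfl⟩ := mem_tensorRel.1 h
  exact ⟨TensorProduct.map f f w, by
    rw [map_add, map_zsmul, map_tensorNorm, TensorProduct.map_tmul]⟩

lemma interchange_eq_of_mem_tensorRel {ε : ℤˣ} {y : M ⊗[ZMod 4] M} {u : M}
    (h : (y, u) ∈ tensorRel M ε) : interchange M y = ε • y := by
  obtain ⟨w, rfl⟩ := mem_tensorRel.1 h
  have h₄ := four_zsmul_eq_zero (u ⊗ₜ[ZMod 4] u)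
  rw [tensorNorm, map_add, map_zsmul, interchange_tmul, map_add]
  obtain rfl | rfl := Int.units_eq_one_or ε
  · rw [one_smul, one_smul, interchange_interchange, add_comm w]
  · rw [tateCoeff_neg_one, Units.neg_smul, one_smul, map_neg, interchange_interchange,
      Units.neg_smul, one_smul, ← sub_eq_zero, ← h₄]
    module

lemma norm_mem_tensorRel (ε : ℤˣ) (w : M ⊗[ZMod 4] M) : (tensorNorm ε w, 0) ∈ tensorRel M ε :=
  ⟨w, by simp⟩

lemma eq_tensorNorm_of_mem_tensorRel {ε : ℤˣ} {y : M ⊗[ZMod 4] M} {t : M}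
    (h : (y, 2 • t) ∈ tensorRel M ε) : ∃ w, y = tensorNorm ε w := by
  obtain ⟨w, rfl⟩ := mem_tensorRel.1 h
  refine ⟨w, ?_⟩
  rw [two_nsmul_tmul_two_nsmul, smul_zero, zero_add]

lemma exists_eq_two_nsmul [Module.Free (ZMod 4) M] {u : M}
    (h : ∀ φ : M →ₗ[ZMod 4] ZMod 4, ∃ t, φ u = 2 * t) : ∃ t, u = 2 • t := by
  obtain ⟨ι, b⟩ := Module.Free.exists_basis (R := ZMod 4) (M := M)
  have H : ∀ x : ZMod 4, (∃ t, x = 2 * t) → x = 2 * (x.val / 2 : ℕ) := by decide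
  refine ⟨b.repr.symm ((b.repr u).mapRange
    (fun x : ZMod 4 => ((x.val / 2 : ℕ) : ZMod 4)) (by decide)), ?_⟩
  refine b.repr.injective (Finsupp.ext fun i => ?_)
  rw [map_nsmul, LinearEquiv.apply_symm_apply, Finsupp.smul_apply, Finsupp.mapRange_apply,
    nsmul_eq_mul]
  exact H _ (h (b.coord i))

/-- Evaluating by `φ ⊗ φ` and multiplying forgets the interchange, so with `x = φ u` the relation
becomes `x² + 2y = 0` or `2x² = 0` in `ℤ/4`. In either case `x` is even. -/
lemma eq_two_nsmul_of_mem_tensorRel [Module.Free (ZMod 4) M] {ε : ℤˣ} {u : M}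
    (h : (0, u) ∈ tensorRel M ε) : ∃ t, u = 2 • t := by
  obtain ⟨w, hw⟩ := mem_tensorRel.1 h
  refine exists_eq_two_nsmul fun φ => ?_
  let Φ := LinearMap.mul' (ZMod 4) (ZMod 4) ∘ₗ TensorProduct.map φ φ
  have hΦ (x) : Φ (interchange M x) = Φ x := by
    induction x with
    | zero => simp
    | tmul x y => exact mul_comm _ _
    | add x y hx hy => rw [map_add, map_add, map_add, hx, hy]
  have h := congrArg Φ hw
  rw [map_zero, map_add, map_zsmul, tensorNorm, map_add, Units.smul_def, map_zsmul, hΦ] at h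
  change 0 = tateCoeff ε • (φ u * φ u) + _ at h
  generalize φ u = x at *
  generalize Φ w = y at *
  obtain rfl | rfl := Int.units_eq_one_or ε
  · rw [tateCoeff_one, one_smul, Units.val_one, one_smul] at h
    revert x y
    decide
  · rw [tateCoeff_neg_one, Units.val_neg, Units.val_one, neg_smul, one_smul, add_neg_cancel,
      add_zero, two_smul] at h
    revert x y
    decide

/-- In an ordered basis the part of `y` above the diagonal has as norm the whole off-diagonal part.
For `ε = -1` a diagonal coefficient satisfies `a = -a`, so it is even: this is where the coefficient
two comes from. -/
lemma exists_mem_tensorRel [Module.Free (ZMod 4) M] {ε : ℤˣ} {y : M ⊗[ZMod 4] M}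
    (h : interchange M y = ε • y) : ∃ u, (y, u) ∈ tensorRel M ε := by
  obtain ⟨ι, b⟩ := Module.Free.exists_basis (R := ZMod 4) (M := M)
  let _ : LinearOrder ι := IsWellOrder.linearOrder WellOrderingRel
  let B := b.tensorProduct b
  have hB (x : M ⊗[ZMod 4] M) (i j : ι) : B.repr (interchange M x) (i, j) = B.repr x (j, i) := by
    induction x with
    | zero => simp
    | tmul x y =>
      rw [interchange_tmul, Module.Basis.tensorProduct_repr_tmul_apply,
        Module.Basis.tensorProduct_repr_tmul_apply]
      exact mul_comm _ _
    | add x y hx hy => simp only [map_add, Finsupp.add_apply, hx, hy]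
  have hy (i j : ι) : B.repr y (j, i) = ε • B.repr y (i, j) := by
    rw [← hB, h, Units.smul_def, map_zsmul, Finsupp.smul_apply, Units.smul_def]
  let w := B.repr.symm ((B.repr y).filter fun p => p.1 < p.2)
  let D := B.repr.symm ((B.repr y).filter fun p => p.1 = p.2)
  have hyD : y = D + tensorNorm ε w := by
    refine B.repr.injective (Finsupp.ext fun ⟨i, j⟩ => ?_)
    rw [tensorNorm, map_add, map_add, Units.smul_def, map_zsmul, Finsupp.add_apply,
      Finsupp.add_apply, Finsupp.smul_apply, hB, LinearEquiv.apply_symm_apply,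
      LinearEquiv.apply_symm_apply]
    simp only [Finsupp.filter_apply]
    obtain hij | rfl | hij := lt_trichotomy i j
    · simp [hij, hij.ne, hij.not_gt]
    · simp
    · simp [hij, hij.ne', hij.not_gt, hy j i, Units.smul_def]
  let P : AddSubgroup (M ⊗[ZMod 4] M) := (tensorRel M ε).map (AddMonoidHom.fst _ _)
  suffices H : D ∈ P by
    obtain ⟨⟨_, u⟩, hu, rfl⟩ := H
    refine ⟨u, ?_⟩
    have := add_mem hu (norm_mem_tensorRel ε w)
    rwa [Prod.mk_add_mk, add_zero, ← hyD] at this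
  rw [← B.linearCombination_repr D, Finsupp.linearCombination_apply]
  refine sum_mem fun ⟨i, j⟩ _ => ?_
  simp only [D, LinearEquiv.apply_symm_apply, Finsupp.filter_apply]
  split_ifs with hij
  · obtain rfl : i = j := hij
    have hb : tateCoeff ε • B (i, i) ∈ P := ⟨(_, b i), ⟨0, by simp [tensorNorm, B]; rfl⟩, rfl⟩
    have hc : ∃ k : ℕ, B.repr y (i, i) • B (i, i) = k • tateCoeff ε • B (i, i) := by
      have := hy i i
      generalize B.repr y (i, i) = a at *
      obtain rfl | rfl := Int.units_eq_one_or ε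
      · refine ⟨a.val, ?_⟩
        rw [tateCoeff_one, one_smul, ← Nat.cast_smul_eq_nsmul (ZMod 4), ZMod.natCast_zmod_val]
      · rw [Units.neg_smul, one_smul] at this
        have ha : ∀ a : ZMod 4, a = -a → a = ((a.val / 2 : ℕ) : ZMod 4) * 2 := by decide
        refine ⟨a.val / 2, ?_⟩
        rw [tateCoeff_neg_one, ← Nat.cast_smul_eq_nsmul (ZMod 4), ← Int.cast_smul_eq_zsmul (ZMod 4),
          smul_smul]
        exact congrArg (· • _) (ha a this)
    obtain ⟨k, hk⟩ := hc
    rw [hk]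
    exact nsmul_mem hb k
  · rw [zero_smul]
    exact zero_mem _

end Tensors

/-! ### Whitehead's functor on free modules -/

section Whitehead

variable (M : Type) [AddCommGroup M] [Module (ZMod 4) M]

/-- The universal quadratic map. -/
def whiteheadMap : QuadraticMap (ZMod 4) M ((M →₀ ZMod 4) ⧸ whiteheadRelations (ZMod 4) M) :=
  QuadraticMap.ofPolar (fun m => (whiteheadRelations (ZMod 4) M).mkQ (Finsupp.single m 1))
    (fun a m => by
      rw [← pow_two, ← map_smul, ← sub_eq_zero, ← map_sub]
      exact (Submodule.Quotient.mk_eq_zero _).2 (Submodule.subset_span (.smul a m)))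
    (fun m m' n => by
      simp only [QuadraticMap.polar, ← map_sub, ← map_add]
      rw [← sub_eq_zero, ← map_sub, ← sub_sub]
      exact (Submodule.Quotient.mk_eq_zero _).2 (Submodule.subset_span (.add_left m m' n)))
    (fun a m n => by
      simp only [QuadraticMap.polar, ← map_sub, ← map_smul]
      rw [← sub_eq_zero, ← map_sub]
      exact (Submodule.Quotient.mk_eq_zero _).2 (Submodule.subset_span (.smul_left a m n)))

/-- The map `λ(m) ↦ m ⊗ m`. -/
def whiteheadToTensor :
    ((M →₀ ZMod 4) ⧸ whiteheadRelations (ZMod 4) M) →ₗ[ZMod 4] M ⊗[ZMod 4] M :=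
  (whiteheadRelations (ZMod 4) M).liftQ (Finsupp.linearCombination _ fun m => m ⊗ₜ m) (by
    refine Submodule.span_le.2 ?_
    rintro _ (⟨r, m⟩ | ⟨m, m', n⟩ | ⟨r, m, n⟩) <;>
    simp only [SetLike.mem_coe, LinearMap.mem_ker, map_sub, map_smul,
      Finsupp.linearCombination_single, one_smul, TensorProduct.add_tmul, TensorProduct.tmul_add,
      ← TensorProduct.smul_tmul', TensorProduct.tmul_smul] <;> module)

lemma whiteheadToTensor_apply (m : M) : whiteheadToTensor M (whiteheadMap M m) = m ⊗ₜ m :=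
  (Finsupp.linearCombination_single _ _ _).trans (one_smul _ _)

variable {M} in
lemma whiteheadToTensor_naturality {N : Type} [AddCommGroup N] [Module (ZMod 4) N]
    (f : M →ₗ[ZMod 4] N) :
    whiteheadToTensor N ∘ₗ Submodule.mapQ _ _ (Finsupp.lmapDomain (ZMod 4) (ZMod 4) f)
        (whiteheadRelations_le_comap (ZMod 4) f) =
      TensorProduct.map f f ∘ₗ whiteheadToTensor M := by
  refine Submodule.linearMap_qext _ (Finsupp.lhom_ext fun m r => ?_)
  change Finsupp.linearCombination _ _ (Finsupp.mapDomain f (Finsupp.single m r)) =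
    TensorProduct.map f f (Finsupp.linearCombination _ _ (Finsupp.single m r))
  rw [Finsupp.mapDomain_single, Finsupp.linearCombination_single,
    Finsupp.linearCombination_single, map_smul, TensorProduct.map_tmul]

lemma whitehead_induction {P : ((M →₀ ZMod 4) ⧸ whiteheadRelations (ZMod 4) M) → Prop}
    (x : (M →₀ ZMod 4) ⧸ whiteheadRelations (ZMod 4) M) (h₀ : P 0)
    (hadd : ∀ x y, P x → P y → P (x + y))
    (h : ∀ (r : ZMod 4) m, P (r • whiteheadMap M m)) : P x := by
  obtain ⟨f, rfl⟩ := Submodule.mkQ_surjective _ x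
  induction f using Finsupp.induction_linear with
  | zero => exact h₀
  | add f g hf hg => rw [map_add]; exact hadd _ _ hf hg
  | single m r =>
    have := h r m
    rwa [← mul_one r, ← smul_eq_mul, ← Finsupp.smul_single, map_smul]

lemma whiteheadToTensor_mem (x) : whiteheadToTensor M x ∈ symmetricTensors (ZMod 4) M := by
  induction x using whitehead_induction with
  | h₀ => rw [map_zero]; exact zero_mem _
  | hadd x y hx hy => rw [map_add]; exact add_mem hx hy
  | h r m =>
    rw [map_smul, whiteheadToTensor_apply]
    exact Submodule.smul_mem _ _ rfl

/-- On a free module the universal quadratic map is `m ↦ B(m, m)` for some bilinear `B`, not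
necessarily symmetric; the linear map defined by `B` on the tensor square is a left inverse. -/
lemma whiteheadToTensor_injective [Module.Free (ZMod 4) M] :
    Function.Injective (whiteheadToTensor M) := by
  obtain ⟨B, hB⟩ := LinearMap.BilinMap.toQuadraticMap_surjective (whiteheadMap M)
  refine Function.LeftInverse.injective (g := TensorProduct.lift B) fun x => ?_
  induction x using whitehead_induction with
  | h₀ => rw [map_zero, map_zero]
  | hadd x y hx hy => rw [map_add, map_add, hx, hy]
  | h r m =>
    rw [map_smul, map_smul, whiteheadToTensor_apply, TensorProduct.lift.tmul, ← hB]
    rfl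

/-- A symmetric tensor is `u ⊗ u` plus a norm, and the norm `x ⊗ y + y ⊗ x` is the polarisation of
the square. -/
lemma exists_whiteheadToTensor_eq [Module.Free (ZMod 4) M] {y : M ⊗[ZMod 4] M}
    (hy : y ∈ symmetricTensors (ZMod 4) M) : ∃ x, whiteheadToTensor M x = y := by
  obtain ⟨u, w, hw⟩ := exists_mem_tensorRel (ε := 1) (hy.trans (one_smul _ y).symm)
  change y ∈ LinearMap.range (whiteheadToTensor M)
  have hu (u : M) : u ⊗ₜ u ∈ LinearMap.range (whiteheadToTensor M) :=
    ⟨_, whiteheadToTensor_apply M u⟩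
  dsimp only at hw
  rw [hw, tateCoeff_one, one_smul]
  clear hw
  refine add_mem (hu u) ?_
  induction w with
  | zero => simp [tensorNorm]
  | add x y hx hy =>
    rw [tensorNorm_add]
    exact add_mem hx hy
  | tmul x y =>
    have := sub_mem (sub_mem (hu (x + y)) (hu x)) (hu y)
    rw [add_tmul_add_self] at this
    convert this using 1
    rw [tensorNorm, one_smul]
    abel

/-- On free modules, Whitehead's functor is the functor of symmetric tensors. -/
def whiteheadEquiv [Module.Free (ZMod 4) M] :
    ((M →₀ ZMod 4) ⧸ whiteheadRelations (ZMod 4) M) ≃+ symmetricTensors (ZMod 4) M :=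
  AddEquiv.ofBijective
    ((whiteheadToTensor M).codRestrict _ (whiteheadToTensor_mem M)).toAddMonoidHom
    ⟨fun _ _ h => whiteheadToTensor_injective M (congrArg Subtype.val h), fun y => by
      obtain ⟨x, hx⟩ := exists_whiteheadToTensor_eq M y.2
      exact ⟨x, Subtype.ext hx⟩⟩

/-- The restrictions of the two functors to free modules are isomorphic. -/
def freeIso : freeInclusion (ZMod 4) ⋙ F (ZMod 4) ≅
    freeInclusion (ZMod 4) ⋙ Whitehead (ZMod 4) ⋙
      forget₂ (ModuleCat.{0} (ZMod 4)) AddCommGrpCat.{0} :=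
  (NatIso.ofComponents
    (fun M : FreeModuleCat (ZMod 4) =>
      have : Module.Free (ZMod 4) M.obj := M.property
      (whiteheadEquiv M.obj).toAddCommGrpIso)
    (by
      intro M N f
      have : Module.Free (ZMod 4) M.obj := M.property
      have : Module.Free (ZMod 4) N.obj := N.property
      refine AddCommGrpCat.hom_ext (AddMonoidHom.ext fun x => Subtype.ext ?_)
      exact LinearMap.congr_fun (whiteheadToTensor_naturality f.hom.hom) x)).symm

end Whitehead

/-! ### Chain complexes extended by zero -/

section Extension

variable {A B D : ChainComplex AddCommGrpCat.{0} ℕ}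

/-- The terms of a chain complex, shifted by two and extended by zero. -/
def extObj (A : ChainComplex AddCommGrpCat.{0} ℕ) : ℕ → AddCommGrpCat.{0}
  -- With two zero terms every chain group of the complex has an outgoing differential, and
  -- inductions on the degree can start at a zero group, in degree one.
  | 0 => AddCommGrpCat.of PUnit
  | 1 => AddCommGrpCat.of PUnit
  | i + 2 => A.X i

/-- The differential of the extended complex. -/
def extD (A : ChainComplex AddCommGrpCat.{0} ℕ) : ∀ i, extObj A (i + 1) →+ extObj A i
  | 0 => 0
  | 1 => 0
  | i + 2 => (A.d (i + 1) i).hom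

/-- The map of extended complexes induced by a chain map. -/
def extMap (f : A ⟶ B) : ∀ i, extObj A i →+ extObj B i
  | 0 => 0
  | 1 => 0
  | i + 2 => (f.f i).hom

/-- The map of extended complexes induced by a chain homotopy. -/
def extH {f g : A ⟶ B} (K : Homotopy f g) : ∀ i, extObj A i →+ extObj B (i + 1)
  | 0 => 0
  | 1 => 0
  | i + 2 => (K.hom i (i + 1)).hom

lemma extD_extD (i : ℕ) (x : extObj A (i + 2)) : extD A i (extD A (i + 1) x) = 0 := by
  match i, x with
  | 0, _ => rfl
  | 1, _ => rfl
  | i + 2, x => exact congrArg (fun g => g.hom x) (A.d_comp_d (i + 2) (i + 1) i)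

lemma extMap_extD (f : A ⟶ B) (i : ℕ) (x : extObj A (i + 1)) :
    extMap f i (extD A i x) = extD B i (extMap f (i + 1) x) := by
  match i, x with
  | 0, _ => rfl
  | 1, _ => rfl
  | i + 2, x => exact congrArg (fun g => g.hom x) (f.comm (i + 1) i).symm

lemma extMap_id (i : ℕ) (x : extObj A i) : extMap (𝟙 A) i x = x := by
  match i, x with
  | 0, _ => rfl
  | 1, _ => rfl
  | i + 2, x => rfl

lemma extMap_zero (i : ℕ) (x : extObj A i) : extMap (0 : A ⟶ B) i x = 0 := by
  match i, x with
  | 0, _ => rfl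
  | 1, _ => rfl
  | i + 2, x => rfl

lemma extMap_homotopy {f g : A ⟶ B} (K : Homotopy f g) (i : ℕ) (x : extObj A (i + 1)) :
    extMap f (i + 1) x =
      extH K i (extD A i x) + extD B (i + 1) (extH K (i + 1) x) + extMap g (i + 1) x := by
  match i, x with
  | 0, _ => rfl
  | 1, x =>
    have h := K.comm 0
    rw [dNext_eq_zero _ _ (by simp), prevD_eq K.hom (j' := 1) (by simp)] at h
    exact congrArg (fun g => g.hom x) h
  | i + 2, x =>
    have h := K.comm (i + 1)
    rw [dNext_eq K.hom (i' := i) (by simp), prevD_eq K.hom (j' := i + 2) (by simp)] at h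
    exact congrArg (fun g => g.hom x) h

end Extension

/-! ### The tower of a functor -/

section FunctorTower

variable (T : ModuleCat.{0} (ZMod 4) ⥤ AddCommGrpCat.{0})
  {Y Z : SimplicialObject (ModuleCat.{0} (ZMod 4))}

/-- The Moore complex of `T Y`. -/
abbrev mooreComplex (Y : SimplicialObject (ModuleCat.{0} (ZMod 4))) :
    ChainComplex AddCommGrpCat.{0} ℕ :=
  (alternatingFaceMapComplex _).obj (applyLevelwise T Y)

/-- The map of Moore complexes induced by a map of simplicial modules. -/
abbrev mooreMap (f : Y ⟶ Z) : mooreComplex T Y ⟶ mooreComplex T Z :=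
  (alternatingFaceMapComplex _).map (((SimplicialObject.whiskering _ _).obj T).map f)

lemma mooreMap_id : mooreMap T (𝟙 Y) = 𝟙 _ := by
  rw [mooreMap, CategoryTheory.Functor.map_id, CategoryTheory.Functor.map_id]

/-- A sum of maps of groups, with alternating signs. -/
lemma hom_alternating_sum {G H : AddCommGrpCat.{0}} {m : ℕ} (f : Fin m → (G ⟶ H)) (x : G) :
    (∑ j : Fin m, (-1 : ℤ) ^ (j : ℕ) • f j).hom x =
      ∑ j : Fin m, (-1 : ℤ) ^ (j : ℕ) • (f j).hom x := by
  refine (congrArg (fun g : G →+ H => g x) (map_sum AddCommGrpCat.homAddEquiv _ _)).trans ?_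
  rw [AddMonoidHom.finsetSum_apply]
  rfl

lemma mooreComplex_d_apply (i : ℕ) (x : T.obj (Y.obj (op (.mk (i + 1))))) :
    ((mooreComplex T Y).d (i + 1) i).hom x =
      ∑ j : Fin (i + 2), (-1 : ℤ) ^ (j : ℕ) • (T.map (Y.δ j)).hom x := by
  have h : (mooreComplex T Y).d (i + 1) i =
      ∑ j : Fin (i + 2), (-1 : ℤ) ^ (j : ℕ) • T.map (Y.δ j) :=
    AlternatingFaceMapComplex.obj_d_eq _ _
  rw [h]
  exact hom_alternating_sum _ x

/-- The components of the contraction of the cone, restricted to the base and projected to the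
suspension. -/
def suspensionComponent (Y : SimplicialObject (ModuleCat.{0} (ZMod 4))) {i : ℕ} (j : Fin (i + 1)) :
    Y.obj (op (.mk i)) ⟶ (suspension Y).obj (op (.mk (i + 1))) :=
  ((toCone Y).app _ ≫ (coneContraction Y).h j) ≫ (fromCone Y).app _

/-- The contraction of the Moore complex of the cone. -/
def coneHomotopy (Y : SimplicialObject (ModuleCat.{0} (ZMod 4))) :
    Homotopy (mooreMap T (0 : cone Y ⟶ cone Y)) (mooreMap T (𝟙 (cone Y))) :=
  ((coneContraction Y).whiskerRight T).toChainHomotopy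

lemma coneHomotopy_hom_apply (i : ℕ) (x : T.obj ((cone Y).obj (op (.mk i)))) :
    ((coneHomotopy T Y).hom i (i + 1)).hom x =
      - ∑ j : Fin (i + 1), (-1 : ℤ) ^ (j : ℕ) • (T.map ((coneContraction Y).h j)).hom x := by
  have h : (coneHomotopy T Y).hom i (i + 1) =
      -∑ j : Fin (i + 1), (-1 : ℤ) ^ (j : ℕ) • T.map ((coneContraction Y).h j) :=
    SimplicialObject.Homotopy.ToChainHomotopy.hom_eq _ i
  rw [h, ← hom_alternating_sum]
  rfl

variable [T.PreservesZeroMorphisms]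

lemma suspensionHomotopy_hom_apply (i : ℕ) (x : T.obj (Y.obj (op (.mk i)))) :
    ((suspensionHomotopy T Y).hom i (i + 1)).hom x =
      - ∑ j : Fin (i + 1), (-1 : ℤ) ^ (j : ℕ) • (T.map (suspensionComponent Y j)).hom x := by
  have h : (suspensionHomotopy T Y).hom i (i + 1) =
      -∑ j : Fin (i + 1), (-1 : ℤ) ^ (j : ℕ) • T.map (suspensionComponent Y j) := by
    simp only [suspensionHomotopy, Homotopy.trans_hom, Homotopy.ofEq_hom,
      Pi.zero_apply, zero_add, add_zero]
    exact SimplicialObject.Homotopy.ToChainHomotopy.hom_eq _ i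
  rw [h, ← hom_alternating_sum]
  rfl

/-- The suspension on extended complexes. -/
def extS (Y : SimplicialObject (ModuleCat.{0} (ZMod 4))) (i : ℕ) :
    extObj (mooreComplex T Y) i →+ extObj (mooreComplex T (suspension Y)) (i + 1) :=
  extH (suspensionHomotopy T Y) i

lemma extS_eq (i : ℕ) (x : extObj (mooreComplex T Y) i) :
    extS T Y i x = extMap (mooreMap T (fromCone Y)) (i + 1)
      (extH (coneHomotopy T Y) i (extMap (mooreMap T (toCone Y)) i x)) := by
  match i, x with
  | 0, _ => rfl
  | 1, _ => exact (map_zero (extMap (mooreMap T (fromCone Y)) 2)).symm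
  | i + 2, x =>
    refine (suspensionHomotopy_hom_apply T i x).trans (Eq.symm ?_)
    refine (congrArg (T.map ((fromCone Y).app (op (.mk (i + 1))))).hom
      (coneHomotopy_hom_apply T i ((T.map ((toCone Y).app (op (.mk i)))).hom x))).trans ?_
    rw [map_neg, map_sum]
    simp only [map_zsmul, suspensionComponent, T.map_comp]
    rfl

/-- The homotopy runs from zero to the identity, so `K d + d K = -1`; the signs in later chases come
from here. -/
lemma cone_contraction (i : ℕ) (x : extObj (mooreComplex T (cone Y)) (i + 1)) :
    extH (coneHomotopy T Y) i (extD _ i x) + extD _ (i + 1) (extH (coneHomotopy T Y) (i + 1) x) +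
      x = 0 := by
  have h := extMap_homotopy (coneHomotopy T Y) i x
  have h₀ : extMap (mooreMap T (0 : cone Y ⟶ cone Y)) (i + 1) x = 0 := by
    rw [mooreMap, map_applyLevelwise_zero T _ rfl, extMap_zero]
  have h₁ : extMap (mooreMap T (𝟙 (cone Y))) (i + 1) x = x := by
    rw [mooreMap_id, extMap_id]
  rw [h₀, h₁] at h
  exact h.symm

/-- Suspension anticommutes with the differentials, which is why stage `n` of the tower carries the
sign `(-1)ⁿ`. -/
lemma extD_extS (i : ℕ) (x : extObj (mooreComplex T Y) (i + 1)) :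
    extD _ (i + 1) (extS T Y (i + 1) x) = - extS T Y i (extD _ i x) := by
  have h := extMap_homotopy (suspensionHomotopy T Y) i x
  rw [extMap_zero, add_zero] at h
  exact eq_neg_of_add_eq_zero_right h.symm

/-- The sign of the differentials which makes them commute with the suspensions. -/
def towerSign (n : ℕ) : ℤˣ := (-1) ^ n

/-- The tower of the Moore complexes of `T` of the suspensions of `X`. -/
def functorTower (X : SimplicialObject (ModuleCat.{0} (ZMod 4))) : Tower where
  C n i := extObj (mooreComplex T (iteratedSuspension X n)) i
  grp n i := inferInstance
  d n i := (DistribSMul.toAddMonoidHom _ (towerSign n)).comp (extD _ i)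
  s n i := extS T (iteratedSuspension X n) i
  d_d n i x := by
    change towerSign n • extD _ i (towerSign n • extD _ (i + 1) x) = 0
    rw [Units.smul_def, Units.smul_def, map_zsmul, extD_extD, smul_zero, smul_zero]
  d_s n i x := by
    change towerSign (n + 1) • extD _ (i + 1) (extS T _ (i + 1) x) =
      extS T _ i (towerSign n • extD _ i x)
    rw [extD_extS, towerSign, pow_succ, mul_neg, mul_one, Units.neg_smul, smul_neg, neg_neg,
      Units.smul_def, Units.smul_def, map_zsmul]
    rfl

end FunctorTower

/-! ### Suspensions of tensor squares are trivial -/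

section TensorSquare

/-- The map of groups underlying a tensor product of linear maps. -/
def tensorHom {M N : ModuleCat.{0} (ZMod 4)} (f g : M ⟶ N) :
    AddCommGrpCat.of (M ⊗[ZMod 4] M) ⟶ AddCommGrpCat.of (N ⊗[ZMod 4] N) :=
  AddCommGrpCat.ofHom (TensorProduct.map f.hom g.hom).toAddMonoidHom

lemma tensorHom_comp {M N P : ModuleCat.{0} (ZMod 4)} (f g : M ⟶ N) (f' g' : N ⟶ P) :
    tensorHom f g ≫ tensorHom f' g' = tensorHom (f ≫ f') (g ≫ g') := by
  refine AddCommGrpCat.hom_ext (AddMonoidHom.ext fun x => ?_)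
  change TensorProduct.map f'.hom g'.hom (TensorProduct.map f.hom g.hom x) =
    TensorProduct.map (f'.hom ∘ₗ f.hom) (g'.hom ∘ₗ g.hom) x
  rw [TensorProduct.map_comp]
  rfl

lemma tensorHom_zero_left {M N : ModuleCat.{0} (ZMod 4)} (g : M ⟶ N) :
    tensorHom (0 : M ⟶ N) g = 0 := by
  refine AddCommGrpCat.hom_ext (AddMonoidHom.ext fun x => ?_)
  change TensorProduct.map 0 g.hom x = 0
  rw [TensorProduct.map_zero_left]
  rfl

lemma tensorHom_zero_right {M N : ModuleCat.{0} (ZMod 4)} (f : M ⟶ N) :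
    tensorHom f (0 : M ⟶ N) = 0 := by
  refine AddCommGrpCat.hom_ext (AddMonoidHom.ext fun x => ?_)
  change TensorProduct.map f.hom 0 x = 0
  rw [TensorProduct.map_zero_right]
  rfl

/-- The tensor square, as a functor to abelian groups. -/
def tensorSquare : ModuleCat.{0} (ZMod 4) ⥤ AddCommGrpCat.{0} where
  obj M := AddCommGrpCat.of (M ⊗[ZMod 4] M)
  map f := tensorHom f f
  map_id M := by
    refine AddCommGrpCat.hom_ext (AddMonoidHom.ext fun x => ?_)
    change TensorProduct.map LinearMap.id LinearMap.id x = x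
    rw [TensorProduct.map_id]
    rfl
  map_comp f g := (tensorHom_comp f f g g).symm

instance : tensorSquare.PreservesZeroMorphisms where
  map_zero _ _ := tensorHom_zero_left _

variable {Y Z : SimplicialObject (ModuleCat.{0} (ZMod 4))}

/-- The tensor product of a homotopy from zero to `f` and of the constant homotopy of `f`. -/
def tensorHomotopy {f : Y ⟶ Z} (H : SimplicialObject.Homotopy (0 : Y ⟶ Z) f) :
    SimplicialObject.Homotopy (0 : applyLevelwise tensorSquare Y ⟶ applyLevelwise tensorSquare Z)
      (((SimplicialObject.whiskering _ _).obj tensorSquare).map f) where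
  h i := tensorHom (H.h i) ((SimplicialObject.Homotopy.refl f).h i)
  h_zero_comp_δ_zero n := (tensorHom_comp _ _ _ _).trans
    (congrArg₂ tensorHom (H.h_zero_comp_δ_zero n)
      ((SimplicialObject.Homotopy.refl f).h_zero_comp_δ_zero n))
  h_last_comp_δ_last n := (tensorHom_comp _ _ _ _).trans
    ((congrArg (tensorHom · _) (H.h_last_comp_δ_last n)).trans (tensorHom_zero_left _))
  h_succ_comp_δ_castSucc_of_lt i j hij := (tensorHom_comp _ _ _ _).trans
    ((congrArg₂ tensorHom (H.h_succ_comp_δ_castSucc_of_lt i j hij)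
      ((SimplicialObject.Homotopy.refl f).h_succ_comp_δ_castSucc_of_lt i j hij)).trans
        (tensorHom_comp _ _ _ _).symm)
  h_succ_comp_δ_castSucc_succ j := (tensorHom_comp _ _ _ _).trans
    ((congrArg₂ tensorHom (H.h_succ_comp_δ_castSucc_succ j)
      ((SimplicialObject.Homotopy.refl f).h_succ_comp_δ_castSucc_succ j)).trans
        (tensorHom_comp _ _ _ _).symm)
  h_castSucc_comp_δ_succ_of_lt i j hij := (tensorHom_comp _ _ _ _).trans
    ((congrArg₂ tensorHom (H.h_castSucc_comp_δ_succ_of_lt i j hij)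
      ((SimplicialObject.Homotopy.refl f).h_castSucc_comp_δ_succ_of_lt i j hij)).trans
        (tensorHom_comp _ _ _ _).symm)
  h_comp_σ_castSucc_of_le i j hij := (tensorHom_comp _ _ _ _).trans
    ((congrArg₂ tensorHom (H.h_comp_σ_castSucc_of_le i j hij)
      ((SimplicialObject.Homotopy.refl f).h_comp_σ_castSucc_of_le i j hij)).trans
        (tensorHom_comp _ _ _ _).symm)
  h_comp_σ_succ_of_lt i j hij := (tensorHom_comp _ _ _ _).trans
    ((congrArg₂ tensorHom (H.h_comp_σ_succ_of_lt i j hij)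
      ((SimplicialObject.Homotopy.refl f).h_comp_σ_succ_of_lt i j hij)).trans
        (tensorHom_comp _ _ _ _).symm)

/-- The contraction of the cone, restricted to the base. -/
def toConeHomotopy (Y : SimplicialObject (ModuleCat.{0} (ZMod 4))) :
    SimplicialObject.Homotopy (0 : Y ⟶ cone Y) (toCone Y) :=
  cast (by rw [comp_zero, Category.comp_id]) ((coneContraction Y).precomp (toCone Y))

/-- The homotopy from zero to the inclusion of the tensor square in the one of the cone, which
moves only one of the factors. -/
def baseHomotopy (Y : SimplicialObject (ModuleCat.{0} (ZMod 4))) :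
    Homotopy (0 : mooreComplex tensorSquare Y ⟶ mooreComplex tensorSquare (cone Y))
      (mooreMap tensorSquare (toCone Y)) :=
  (Homotopy.ofEq (Functor.map_zero _ _ _).symm).trans
    (tensorHomotopy (toConeHomotopy Y)).toChainHomotopy

lemma neg_alternating_sum_comp_eq_zero {C : Type*} [Category* C] [Preadditive C] {G H K : C}
    {m : ℕ} {f : Fin m → (G ⟶ H)} {g : H ⟶ K} (h : ∀ j, f j ≫ g = 0) :
    (-∑ j : Fin m, (-1 : ℤ) ^ (j : ℕ) • f j) ≫ g = 0 := by
  simp [Preadditive.sum_comp, h]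

/-- The factor that the homotopy does not move stays in the image of `Y`, which is zero in the
suspension. -/
lemma baseHomotopy_hom_comp (i : ℕ) :
    (baseHomotopy Y).hom i (i + 1) ≫
      tensorSquare.map ((fromCone Y).app (op (.mk (i + 1)))) = 0 := by
  have h : (baseHomotopy Y).hom i (i + 1) =
      -∑ j : Fin (i + 1), (-1 : ℤ) ^ (j : ℕ) • (tensorHomotopy (toConeHomotopy Y)).h j := by
    simp only [baseHomotopy, Homotopy.trans_hom, Homotopy.ofEq_hom, Pi.zero_apply, zero_add]
    exact SimplicialObject.Homotopy.ToChainHomotopy.hom_eq _ i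
  refine (congrArg (· ≫ _) h).trans (neg_alternating_sum_comp_eq_zero fun j => ?_)
  have h₂ : (SimplicialObject.Homotopy.refl (toCone Y)).h j ≫
      (fromCone Y).app (op (.mk (i + 1))) = 0 := by
    have := congrArg (fun g : Y ⟶ suspension Y => Y.σ j ≫ g.app (op (.mk (i + 1))))
      (toCone_fromCone Y)
    exact (Category.assoc _ _ _).trans (this.trans comp_zero)
  exact (tensorHom_comp _ _ _ _).trans
    ((congrArg (tensorHom _) h₂).trans (tensorHom_zero_right _))

lemma extMap_fromCone_baseHomotopy (i : ℕ) (x : extObj (mooreComplex tensorSquare Y) i) :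
    extMap (mooreMap tensorSquare (fromCone Y)) (i + 1) (extH (baseHomotopy Y) i x) = 0 := by
  match i, x with
  | 0, _ => rfl
  | 1, _ => exact map_zero (extMap (mooreMap tensorSquare (fromCone Y)) 2)
  | i + 2, x => exact congrArg (fun g => g.hom x) (baseHomotopy_hom_comp i)

/-- The suspension of a cycle of the tensor square is a boundary. -/
lemma exists_extS_eq_extD {i : ℕ} {z : extObj (mooreComplex tensorSquare Y) (i + 1)}
    (hz : extD _ i z = 0) :
    ∃ v, extS tensorSquare Y (i + 1) z = extD _ (i + 2) v := by
  -- Two chains on the cone with boundary `-z`: `k₁` moves both factors, `k₂` only one. Their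
  -- difference is a cycle of a contractible complex, hence a boundary. In the suspension `k₁`
  -- becomes the suspension of `z`, and `k₂` becomes zero.
  set k₁ := extH (coneHomotopy tensorSquare Y) (i + 1) (extMap (mooreMap _ (toCone Y)) (i + 1) z)
    with hk₁
  set k₂ := extH (baseHomotopy Y) (i + 1) z with hk₂
  have h₁ := cone_contraction tensorSquare i (extMap (mooreMap _ (toCone Y)) (i + 1) z)
  rw [← extMap_extD, hz, map_zero, map_zero, zero_add, ← hk₁] at h₁
  have h₂ := extMap_homotopy (baseHomotopy Y) i z
  rw [hz, map_zero, extMap_zero, zero_add, ← hk₂] at h₂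
  have h₃ := cone_contraction tensorSquare (i + 1) (k₁ - k₂)
  have h₄ : extD _ (i + 1) (k₁ - k₂) = 0 := by
    rw [map_sub, eq_neg_of_add_eq_zero_left h₁, eq_neg_of_add_eq_zero_left h₂.symm, sub_self]
  rw [h₄, map_zero, zero_add] at h₃
  refine ⟨-extMap (mooreMap _ (fromCone Y)) _
    (extH (coneHomotopy tensorSquare Y) (i + 2) (k₁ - k₂)), ?_⟩
  rw [extS_eq, ← hk₁, map_neg, ← extMap_extD, eq_neg_of_add_eq_zero_left h₃, map_neg, neg_neg,
    map_sub, hk₂, extMap_fromCone_baseHomotopy, sub_zero]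

end TensorSquare

/-! ### Homology modulo two of a simplicial module and of its suspension -/

section ModTwo

/-- Cycles modulo two of an extended complex. -/
def ExtCycleTwo {A : ChainComplex AddCommGrpCat.{0} ℕ} {i : ℕ} (u : extObj A (i + 1)) : Prop :=
  ∃ t, extD A i u = 2 • t

/-- Boundaries modulo two of an extended complex. -/
def ExtBoundaryTwo {A : ChainComplex AddCommGrpCat.{0} ℕ} {i : ℕ} (u : extObj A (i + 1)) : Prop :=
  ∃ v t, u = extD A (i + 1) v + 2 • t

lemma ExtBoundaryTwo.sub {A : ChainComplex AddCommGrpCat.{0} ℕ} {i : ℕ} {u u' : extObj A (i + 1)}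
    (h : ExtBoundaryTwo u) (h' : ExtBoundaryTwo u') : ExtBoundaryTwo (u - u') := by
  obtain ⟨v, t, rfl⟩ := h
  obtain ⟨v', t', rfl⟩ := h'
  exact ⟨v - v', t - t', by rw [map_sub, smul_sub]; abel⟩

/-- The underlying group of a module. -/
abbrev underlying : ModuleCat.{0} (ZMod 4) ⥤ AddCommGrpCat.{0} := forget₂ _ _

variable {Y : SimplicialObject (ModuleCat.{0} (ZMod 4))}

/-- Evaluation at vertex zero retracts the cone onto `Y` level by level, so `Y` modulo two injects
into the cone modulo two. -/
lemma exists_eq_two_of_extMap_toCone {i : ℕ} {x : extObj (mooreComplex underlying Y) i}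
    {e} (h : extMap (mooreMap underlying (toCone Y)) i x = 2 • e) : ∃ y, x = 2 • y := by
  match i, x, e, h with
  | 0, _, _, _ => exact ⟨0, rfl⟩
  | 1, _, _, _ => exact ⟨0, rfl⟩
  | i + 2, x, e, h =>
    have h : (fun _ => x : Fin (i + 1) → Y.obj (op (.mk i))) =
        2 • (e : Fin (i + 1) → Y.obj (op (.mk i))) := h
    exact ⟨(e : Fin (i + 1) → Y.obj (op (.mk i))) 0, congrFun h 0⟩

lemma extMap_fromCone_surjective (i : ℕ) :
    Function.Surjective (extMap (mooreMap underlying (fromCone Y)) i) := by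
  match i with
  | 0 => exact fun _ => ⟨0, rfl⟩
  | 1 => exact fun _ => ⟨0, rfl⟩
  | i + 2 => exact Submodule.mkQ_surjective (LinearMap.range ((toCone Y).app (op (.mk i))).hom)

lemma exists_extMap_toCone_eq {i : ℕ} {e : extObj (mooreComplex underlying (cone Y)) i}
    (h : extMap (mooreMap underlying (fromCone Y)) i e = 0) :
    ∃ x, extMap (mooreMap underlying (toCone Y)) i x = e := by
  match i, e, h with
  | 0, _, _ => exact ⟨0, rfl⟩
  | 1, _, _ => exact ⟨0, rfl⟩
  | i + 2, e, h =>
    exact (Submodule.Quotient.mk_eq_zero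
      (LinearMap.range ((toCone Y).app (op (.mk i))).hom)).1 h

/-- Suspension is surjective on homology modulo two: the long exact sequence of `0 → Y → E Y → B Y →
0` modulo two, with `E Y` contractible. -/
lemma exists_sub_extS {i : ℕ} {y : extObj (mooreComplex underlying (suspension Y)) (i + 2)}
    (hy : ExtCycleTwo y) : ∃ x : extObj (mooreComplex underlying Y) (i + 1),
      ExtCycleTwo x ∧ ExtBoundaryTwo (y - extS underlying Y (i + 1) x) := by
  obtain ⟨t, ht⟩ := hy
  obtain ⟨e, rfl⟩ := extMap_fromCone_surjective _ y
  obtain ⟨e', rfl⟩ := extMap_fromCone_surjective _ t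
  obtain ⟨x, hx⟩ := exists_extMap_toCone_eq (e := extD _ (i + 1) e - 2 • e') (by
    rw [map_sub, map_nsmul, extMap_extD, ht, sub_self])
  obtain ⟨x', hx'⟩ : ∃ x', extD _ i x = 2 • x' := exists_eq_two_of_extMap_toCone
    (e := -extD _ i e') (by rw [extMap_extD, hx, map_sub, extD_extD, map_nsmul, smul_neg, zero_sub])
  have h₁ := cone_contraction underlying (Y := Y) i (extMap (mooreMap _ (toCone Y)) _ x)
  rw [← extMap_extD, hx', map_nsmul, map_nsmul, hx] at h₁
  set k := extH (coneHomotopy underlying Y) i (extMap (mooreMap underlying (toCone Y)) i x')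
  -- A lift of `y` plus the suspension of `x`, corrected to be a cycle modulo two of the cone; the
  -- contraction makes it a boundary modulo two.
  set f := e + extH (coneHomotopy underlying Y) _ (extMap (mooreMap _ (toCone Y)) _ x) with hf
  have hdf : extD _ (i + 1) f = 2 • (e' - k) := by
    rw [hf, map_add, hx, smul_sub, ← sub_eq_zero, ← h₁]
    abel
  have h₂ := cone_contraction underlying (Y := Y) (i + 1) f
  rw [hdf, map_nsmul] at h₂
  refine ⟨-x, ⟨-x', by rw [map_neg, hx', smul_neg]⟩, ?_⟩
  rw [map_neg, sub_neg_eq_add, extS_eq, ← map_add, ← hf]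
  refine ⟨-extMap (mooreMap underlying (fromCone Y)) _ (extH (coneHomotopy underlying Y) _ f),
    -extMap (mooreMap underlying (fromCone Y)) _ (extH (coneHomotopy underlying Y) _ (e' - k)), ?_⟩
  have h₃ := congrArg (extMap (mooreMap underlying (fromCone Y)) (i + 2)) h₂
  rw [map_add, map_add, map_zero, map_nsmul, extMap_extD] at h₃
  rw [map_neg, smul_neg, eq_neg_of_add_eq_zero_right h₃]
  abel

/-- Injectivity in the same long exact sequence. The chain `k` has boundary `-x` modulo two; if its
image bounds modulo two, `k` can be corrected to come from a chain `x₁` of `Y`, and then `x + d x₁`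
is even. -/
lemma extBoundaryTwo_of_extS {i : ℕ} {x : extObj (mooreComplex underlying Y) (i + 1)}
    (hx : ExtCycleTwo x) (h : ExtBoundaryTwo (extS underlying Y (i + 1) x)) :
    ExtBoundaryTwo x := by
  obtain ⟨x', hx'⟩ := hx
  obtain ⟨b, b', hb⟩ := h
  obtain ⟨e, rfl⟩ := extMap_fromCone_surjective _ b
  obtain ⟨e', rfl⟩ := extMap_fromCone_surjective _ b'
  set k := extH (coneHomotopy underlying Y) (i + 1) (extMap (mooreMap underlying (toCone Y)) _ x)
    with hk
  obtain ⟨x₁, hx₁⟩ := exists_extMap_toCone_eq (e := k - extD _ (i + 2) e - 2 • e') (by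
    rw [map_sub, map_sub, map_nsmul, extMap_extD, hk, ← extS_eq, hb]
    abel)
  have h₁ := cone_contraction underlying (Y := Y) i (extMap (mooreMap _ (toCone Y)) _ x)
  rw [← extMap_extD, hx', map_nsmul, map_nsmul, ← hk] at h₁
  have h₂ := congrArg (extD _ (i + 1)) hx₁
  rw [map_sub, map_sub, extD_extD, map_nsmul, ← extMap_extD] at h₂
  obtain ⟨y, hy⟩ := exists_eq_two_of_extMap_toCone (x := x + extD _ (i + 1) x₁)
    (e := -(extH (coneHomotopy underlying Y) i (extMap (mooreMap underlying (toCone Y)) i x') +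
      extD _ (i + 1) e')) (by
    rw [map_add, h₂, eq_neg_of_add_eq_zero_right h₁]
    rw [smul_neg, smul_add]
    abel)
  exact ⟨-x₁, y, by rw [map_neg, ← hy]; abel⟩

end ModTwo

/-! ### Homology modulo two of a free model of `ℤ/2` -/

section FreeModel

variable {X : SimplicialObject (ModuleCat.{0} (ZMod 4))}

lemma extObj_exists_eq_two (hX : ∀ m, Module.Free (ZMod 4) (X.obj (op (.mk m)))) {i : ℕ}
    {x : extObj (mooreComplex underlying X) i} (h : 2 • x = 0) : ∃ y, x = 2 • y := by
  match i, x, h with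
  | 0, _, _ => exact ⟨0, rfl⟩
  | 1, _, _ => exact ⟨0, rfl⟩
  | i + 2, x, h =>
    have := hX i
    have h : (2 • x : X.obj (op (.mk i))) = 0 := h
    exact exists_eq_two_nsmul (M := X.obj (op (.mk i))) (u := x) fun φ => by
      have hφ : 2 • φ x = 0 := (map_nsmul φ 2 x).symm.trans ((congrArg φ h).trans (map_zero φ))
      generalize φ x = a at hφ
      revert a
      decide

lemma extObj_four_nsmul {i : ℕ} (x : extObj (mooreComplex underlying X) i) : 2 • 2 • x = 0 := by
  match i, x with
  | 0, _ => rfl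
  | 1, _ => rfl
  | i + 2, x =>
    exact (smul_smul 2 2 x).trans (four_nsmul_eq_zero (M := X.obj (op (.mk i))) x)

lemma moduleCat_complex_d_apply (i : ℕ) (x : X.obj (op (.mk (i + 1)))) :
    (((alternatingFaceMapComplex _).obj X).d (i + 1) i).hom x =
      ((mooreComplex underlying X).d (i + 1) i).hom x := by
  have h : ((alternatingFaceMapComplex _).obj X).d (i + 1) i =
      ∑ j : Fin (i + 2), (-1 : ℤ) ^ (j : ℕ) • X.δ j :=
    AlternatingFaceMapComplex.obj_d_eq _ _
  rw [h]
  refine ((congrArg (fun g : X.obj (op (.mk (i + 1))) →ₗ[ZMod 4] X.obj (op (.mk i)) => g x)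
    (map_sum ModuleCat.homAddEquiv _ _)).trans ?_).trans (mooreComplex_d_apply underlying i x).symm
  rw [LinearMap.sum_apply]
  rfl

/-- The positive homology groups of a free model of `M` vanish. -/
lemma exists_extD_eq {M : ModuleCat.{0} (ZMod 4)} (hX : IsFreeModel M 0 X) {i : ℕ}
    {x : extObj (mooreComplex underlying X) (i + 3)} (h : extD _ (i + 2) x = 0) :
    ∃ y, extD _ (i + 3) y = x := by
  have h₁ := (HomologicalComplex.exactAt_iff_isZero_homology _ _).2 (hX.isZero (i + 1) (by simp))
  rw [HomologicalComplex.exactAt_iff' _ (i + 2) (i + 1) i (by simp) (by simp),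
    ShortComplex.moduleCat_exact_iff] at h₁
  obtain ⟨y, hy⟩ := h₁ x ((moduleCat_complex_d_apply i x).trans h)
  exact ⟨y, (moduleCat_complex_d_apply (i + 1) y).symm.trans hy⟩

/-- In degree zero homology is the cokernel of the differential, here identified with `ℤ/2`. -/
lemma exists_augmentation (hX : IsFreeModel zmodTwo 0 X) :
    ∃ θ : extObj (mooreComplex underlying X) 2 →+ ZMod 2, Function.Surjective θ ∧
      ∀ x, θ x = 0 ↔ ∃ y, extD _ 2 y = x := by
  obtain ⟨φ⟩ := hX.nonempty_iso
  let K := (alternatingFaceMapComplex _).obj X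
  have : IsIso (K.homologyι 0) := inferInstance
  let p := K.pOpcycles 0 ≫ inv (K.homologyι 0) ≫ φ.hom
  have hp : Function.Surjective p.hom := (ModuleCat.epi_iff_surjective p).1 inferInstance
  have hS := ShortComplex.exact_of_g_is_cokernel
    (ShortComplex.mk _ _ (K.d_pOpcycles 1 0)) (K.opcyclesIsCokernel 1 0 (by simp))
  rw [ShortComplex.moduleCat_exact_iff] at hS
  refine ⟨p.hom.toAddMonoidHom, hp, fun x => ⟨fun h => ?_, ?_⟩⟩
  · have : K.pOpcycles 0 x = 0 := by
      refine (ModuleCat.mono_iff_injective (inv (K.homologyι 0) ≫ φ.hom)).1 inferInstance ?_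
      exact h.trans (map_zero (inv (K.homologyι 0) ≫ φ.hom).hom).symm
    obtain ⟨y, hy⟩ := hS x this
    exact ⟨y, (moduleCat_complex_d_apply 0 y).symm.trans hy⟩
  · rintro ⟨y, rfl⟩
    have h := congrArg (fun g => g.hom y) (K.d_pOpcycles 1 0)
    refine (congrArg p.hom (moduleCat_complex_d_apply 0 y).symm).trans ?_
    exact (congrArg (inv (K.homologyι 0) ≫ φ.hom).hom h).trans (map_zero _)

/-- The connecting homomorphism of multiplication by two. -/
lemma extBoundaryTwo_iff (hX : IsFreeModel zmodTwo 0 X) {i : ℕ}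
    {u : extObj (mooreComplex underlying X) (i + 3)} {t} (h : extD _ (i + 2) u = 2 • t) :
    ExtBoundaryTwo u ↔ ExtBoundaryTwo t := by
  constructor
  -- Here `2t = 2 d s`, so `t - d s` is killed by two and is even by freeness.
  · rintro ⟨v, s, rfl⟩
    rw [map_add, extD_extD, zero_add, map_nsmul, eq_comm, ← sub_eq_zero, ← smul_sub] at h
    obtain ⟨r, hr⟩ := extObj_exists_eq_two hX.free h
    exact ⟨s, r, by rw [← hr]; abel⟩
  -- Since four is zero, `d u = d (2s)`; then `u - 2s` is a cycle in positive degree, hence a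
  -- boundary.
  · rintro ⟨s, r, rfl⟩
    rw [smul_add, extObj_four_nsmul, add_zero, ← map_nsmul, ← sub_eq_zero, ← map_sub] at h
    obtain ⟨y, hy⟩ := exists_extD_eq hX h
    exact ⟨y, s, by rw [hy]; abel⟩

lemma ExtCycleTwo.of_extD (hX : IsFreeModel zmodTwo 0 X) {i : ℕ}
    {u : extObj (mooreComplex underlying X) (i + 3)} {t} (h : extD _ (i + 2) u = 2 • t) :
    ExtCycleTwo t := by
  have := congrArg (extD _ (i + 1)) h
  rw [extD_extD, map_nsmul] at this
  exact extObj_exists_eq_two hX.free this.symm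

/-- Surjectivity of the connecting homomorphism. In positive degrees `2t` is a cycle and therefore
bounds; in degree zero it bounds because two kills `H₀ = ℤ/2`. -/
lemma ExtCycleTwo.exists_extD_eq (hX : IsFreeModel zmodTwo 0 X) {i : ℕ}
    {t : extObj (mooreComplex underlying X) (i + 2)} (h : ExtCycleTwo t) :
    ∃ u, extD _ (i + 2) u = 2 • t := by
  match i, t, h with
  | 0, t, h =>
    obtain ⟨θ, -, hθ⟩ := exists_augmentation hX
    refine (hθ _).1 ?_
    rw [map_nsmul]
    generalize θ t = a
    revert a
    decide
  | i + 1, t, ⟨r, hr⟩ =>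
    refine StableDerived.exists_extD_eq hX ?_
    rw [map_nsmul, hr, extObj_four_nsmul]

lemma extBoundaryTwo_iff_augmentation {θ : extObj (mooreComplex underlying X) 2 →+ ZMod 2}
    (hθ : ∀ x, θ x = 0 ↔ ∃ y, extD _ 2 y = x) (u) : ExtBoundaryTwo u ↔ θ u = 0 := by
  have h₂ (t) : θ (2 • t) = 0 := by
    rw [map_nsmul]
    generalize θ t = a
    revert a
    decide
  constructor
  · rintro ⟨v, t, rfl⟩
    rw [map_add, h₂, (hθ _).2 ⟨v, rfl⟩, add_zero]
  · intro h
    obtain ⟨y, hy⟩ := (hθ _).1 h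
    exact ⟨y, 0, by rw [hy, smul_zero, add_zero]⟩

/-- The generator of `H₀` is lifted through the connecting homomorphisms, which are isomorphisms on
homology modulo two. -/
lemma exists_not_extBoundaryTwo (hX : IsFreeModel zmodTwo 0 X) (i : ℕ) :
    ∃ u : extObj (mooreComplex underlying X) (i + 2), ExtCycleTwo u ∧ ¬ ExtBoundaryTwo u := by
  induction i with
  | zero =>
    obtain ⟨θ, hs, hθ⟩ := exists_augmentation hX
    obtain ⟨u, hu⟩ := hs 1
    refine ⟨u, ⟨0, rfl⟩, fun h => ?_⟩
    rw [extBoundaryTwo_iff_augmentation hθ, hu] at h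
    exact one_ne_zero h
  | succ i ih =>
    obtain ⟨t, ht, ht'⟩ := ih
    obtain ⟨u, hu⟩ := ht.exists_extD_eq hX
    exact ⟨u, ⟨t, hu⟩, by rwa [extBoundaryTwo_iff hX hu]⟩

lemma extBoundaryTwo_sub (hX : IsFreeModel zmodTwo 0 X) {i : ℕ}
    {u u' : extObj (mooreComplex underlying X) (i + 2)} (hu : ExtCycleTwo u) (hu' : ExtCycleTwo u')
    (hb : ¬ ExtBoundaryTwo u) (hb' : ¬ ExtBoundaryTwo u') : ExtBoundaryTwo (u - u') := by
  induction i with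
  | zero =>
    obtain ⟨θ, -, hθ⟩ := exists_augmentation hX
    rw [extBoundaryTwo_iff_augmentation hθ] at *
    rw [map_sub]
    generalize θ u = a at *
    generalize θ u' = a' at *
    revert a a'
    decide
  | succ i ih =>
    obtain ⟨t, ht⟩ := hu
    obtain ⟨t', ht'⟩ := hu'
    rw [extBoundaryTwo_iff hX ht] at hb
    rw [extBoundaryTwo_iff hX ht'] at hb'
    rw [extBoundaryTwo_iff hX (t := t - t') (by rw [map_sub, ht, ht', smul_sub])]
    exact ih (.of_extD hX ht) (.of_extD hX ht') hb hb'

end FreeModel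

/-! ### The tower of tensor squares of the suspensions of a free model -/

section TensorTower

lemma mk_mem_of_eq {A B : Type*} [AddCommGroup A] [AddCommGroup B] {S : AddSubgroup (A × B)}
    {a a' : A} {b b' : B} (ha : a = a') (hb : b = b') (h : (a', b') ∈ S) : (a, b) ∈ S := by
  rwa [ha, hb]

lemma sum_mem_tensorRel {M N : Type} [AddCommGroup M] [Module (ZMod 4) M] [AddCommGroup N]
    [Module (ZMod 4) N] {m : ℕ} (c : Fin m → ℤ) (f : Fin m → (M →ₗ[ZMod 4] N)) {ε : ℤˣ}
    {y : M ⊗[ZMod 4] M} {u : M} (h : (y, u) ∈ tensorRel M ε) :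
    (∑ j, c j • TensorProduct.map (f j) (f j) y, ∑ j, c j • f j u) ∈ tensorRel N ε := by
  have := sum_mem (S := tensorRel N ε) (t := Finset.univ)
    fun j _ => zsmul_mem (map_mem_tensorRel (f j) h) (c j)
  convert this
  · rw [Prod.fst_sum]
    rfl
  · rw [Prod.snd_sum]
    rfl

variable {Y : SimplicialObject (ModuleCat.{0} (ZMod 4))}

variable (Y) in
/-- The interchange of the factors on the tensor squares. -/
def extSwap : ∀ i, extObj (mooreComplex tensorSquare Y) i →+ extObj (mooreComplex tensorSquare Y) i
  | 0 => AddMonoidHom.id _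
  | 1 => AddMonoidHom.id _
  | i + 2 => (interchange (Y.obj (op (.mk i)))).toAddMonoidHom

variable (Y) in
/-- The relation `tensorRel` in all degrees. -/
def extRel (ε : ℤˣ) : ∀ i, AddSubgroup
    (extObj (mooreComplex tensorSquare Y) i × extObj (mooreComplex underlying Y) i)
  | 0 => ⊤
  | 1 => ⊤
  | i + 2 => tensorRel (Y.obj (op (.mk i))) ε

lemma extSwap_extSwap (i : ℕ) (x : extObj (mooreComplex tensorSquare Y) i) :
    extSwap Y i (extSwap Y i x) = x := by
  match i, x with
  | 0, _ => rfl
  | 1, _ => rfl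
  | i + 2, x => exact interchange_interchange (M := Y.obj (op (.mk i))) x

lemma tmul_self_mem_tensorRel {M : Type} [AddCommGroup M] [Module (ZMod 4) M] (ε : ℤˣ) (u : M) :
    (tateCoeff ε • (u ⊗ₜ[ZMod 4] u), u) ∈ tensorRel M ε :=
  ⟨0, by simp [tensorNorm]⟩

lemma interchange_sum_map {M N : Type} [AddCommGroup M] [Module (ZMod 4) M] [AddCommGroup N]
    [Module (ZMod 4) N] {m : ℕ} (c : Fin m → ℤ) (f : Fin m → (M →ₗ[ZMod 4] N))
    (y : M ⊗[ZMod 4] M) :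
    interchange N (∑ j, c j • TensorProduct.map (f j) (f j) y) =
      ∑ j, c j • TensorProduct.map (f j) (f j) (interchange M y) := by
  rw [map_sum]
  exact Finset.sum_congr rfl fun j _ => by rw [map_zsmul, interchange_map]

lemma extSwap_extD (i : ℕ) (x : extObj (mooreComplex tensorSquare Y) (i + 1)) :
    extSwap Y i (extD _ i x) = extD _ i (extSwap Y (i + 1) x) := by
  match i, x with
  | 0, _ => rfl
  | 1, _ => rfl
  | i + 2, x =>
    refine (congrArg (interchange (Y.obj (op (.mk i))))
      (mooreComplex_d_apply tensorSquare i x)).trans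
      (Eq.trans ?_ (mooreComplex_d_apply tensorSquare i _).symm)
    exact interchange_sum_map (M := Y.obj (op (.mk (i + 1)))) (N := Y.obj (op (.mk i))) _
      (fun j => (Y.δ j).hom) x

lemma extSwap_extS (i : ℕ) (x : extObj (mooreComplex tensorSquare Y) i) :
    extSwap (suspension Y) (i + 1) (extS tensorSquare Y i x) =
      extS tensorSquare Y i (extSwap Y i x) := by
  match i, x with
  | 0, _ => rfl
  | 1, _ => exact map_zero (extSwap (suspension Y) 2)
  | i + 2, x =>
    refine (congrArg (interchange ((suspension Y).obj (op (.mk (i + 1)))))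
      (suspensionHomotopy_hom_apply tensorSquare i x)).trans
      (Eq.trans ?_ (suspensionHomotopy_hom_apply tensorSquare i _).symm)
    refine (map_neg _ _).trans (congrArg Neg.neg ?_)
    exact interchange_sum_map (M := Y.obj (op (.mk i)))
      (N := (suspension Y).obj (op (.mk (i + 1)))) _ (fun j => (suspensionComponent Y j).hom) x

lemma extD_mem_extRel {ε : ℤˣ} {i : ℕ} {y u} (h : (y, u) ∈ extRel Y ε (i + 1)) :
    (extD _ i y, extD _ i u) ∈ extRel Y ε i := by
  match i, y, u, h with
  | 0, _, _, _ => exact AddSubgroup.mem_top _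
  | 1, _, _, _ => exact AddSubgroup.mem_top _
  | i + 2, y, u, h =>
    have := sum_mem_tensorRel (M := Y.obj (op (.mk (i + 1)))) (N := Y.obj (op (.mk i)))
      (fun j : Fin (i + 2) => (-1) ^ (j : ℕ)) (fun j => (Y.δ j).hom) h
    exact mk_mem_of_eq (mooreComplex_d_apply tensorSquare i y) (mooreComplex_d_apply underlying i u)
      this

lemma extS_mem_extRel {ε : ℤˣ} {i : ℕ} {y u} (h : (y, u) ∈ extRel Y ε i) :
    (extS tensorSquare Y i y, extS underlying Y i u) ∈ extRel (suspension Y) ε (i + 1) := by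
  match i, y, u, h with
  | 0, _, _, _ => exact AddSubgroup.mem_top _
  | 1, _, _, _ => exact zero_mem (extRel (suspension Y) ε 2)
  | i + 2, y, u, h =>
    have := neg_mem (sum_mem_tensorRel (M := Y.obj (op (.mk i)))
      (N := (suspension Y).obj (op (.mk (i + 1))))
      (fun j : Fin (i + 1) => (-1) ^ (j : ℕ)) (fun j => (suspensionComponent Y j).hom) h)
    exact mk_mem_of_eq (suspensionHomotopy_hom_apply tensorSquare i y)
      (suspensionHomotopy_hom_apply underlying i u) this

lemma extSwap_eq_of_mem_extRel {ε : ℤˣ} {i : ℕ} {y u} (h : (y, u) ∈ extRel Y ε i) :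
    extSwap Y i y = ε • y := by
  match i, y, u, h with
  | 0, _, _, _ => rfl
  | 1, _, _, _ => rfl
  | i + 2, y, u, h => exact interchange_eq_of_mem_tensorRel (M := Y.obj (op (.mk i))) h

lemma exists_mem_extRel_right (ε : ℤˣ) {i : ℕ} (u) : ∃ y, (y, u) ∈ extRel Y ε i := by
  match i, u with
  | 0, _ => exact ⟨0, AddSubgroup.mem_top _⟩
  | 1, _ => exact ⟨0, AddSubgroup.mem_top _⟩
  | i + 2, u =>
    exact ⟨_, tmul_self_mem_tensorRel (M := Y.obj (op (.mk i))) ε u⟩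

lemma norm_mem_extRel (ε : ℤˣ) {i : ℕ} (w) : (w + ε • extSwap Y i w, 0) ∈ extRel Y ε i := by
  match i, w with
  | 0, _ => exact AddSubgroup.mem_top _
  | 1, _ => exact AddSubgroup.mem_top _
  | i + 2, w => exact norm_mem_tensorRel (M := Y.obj (op (.mk i))) ε w

lemma eq_norm_of_mem_extRel {ε : ℤˣ} {i : ℕ} {y t} (h : (y, 2 • t) ∈ extRel Y ε i) :
    ∃ w, y = w + ε • extSwap Y i w := by
  match i, y, t, h with
  | 0, _, _, _ => exact ⟨0, rfl⟩
  | 1, _, _, _ => exact ⟨0, rfl⟩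
  | i + 2, y, t, h => exact eq_tensorNorm_of_mem_tensorRel (M := Y.obj (op (.mk i))) h

lemma exists_mem_extRel_left (hY : ∀ m, Module.Free (ZMod 4) (Y.obj (op (.mk m)))) {ε : ℤˣ} {i : ℕ}
    {y} (h : extSwap Y i y = ε • y) : ∃ u, (y, u) ∈ extRel Y ε i := by
  match i, y, h with
  | 0, _, _ => exact ⟨0, AddSubgroup.mem_top _⟩
  | 1, _, _ => exact ⟨0, AddSubgroup.mem_top _⟩
  | i + 2, y, h =>
    have := hY i
    exact exists_mem_tensorRel (M := Y.obj (op (.mk i))) h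

lemma eq_two_nsmul_of_mem_extRel (hY : ∀ m, Module.Free (ZMod 4) (Y.obj (op (.mk m)))) {ε : ℤˣ}
    {i : ℕ} {u} (h : (0, u) ∈ extRel Y ε i) : ∃ t, u = 2 • t := by
  match i, u, h with
  | 0, _, _ => exact ⟨0, rfl⟩
  | 1, _, _ => exact ⟨0, rfl⟩
  | i + 2, u, h =>
    have := hY i
    exact eq_two_nsmul_of_mem_tensorRel (M := Y.obj (op (.mk i))) h

lemma δ_PInfty_apply {i : ℕ} (j : Fin (i + 1)) (u : Y.obj (op (.mk (i + 1)))) :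
    (Y.δ j.succ).hom ((DoldKan.PInfty (X := applyLevelwise underlying Y)).f (i + 1) u) = 0 := by
  have := DoldKan.HigherFacesVanish.of_P (X := applyLevelwise underlying Y) (i + 1) i j (by omega)
  exact congrArg (fun g => g.hom u) this

/-- A cycle modulo two is homologous to one all of whose faces vanish modulo two. -/
lemma exists_cycle_mem_extRel (ε : ℤˣ) {i : ℕ} {u : extObj (mooreComplex underlying Y) (i + 1)}
    (h : ExtCycleTwo u) : ∃ y u', (y, u') ∈ extRel Y ε (i + 1) ∧ extD _ i y = 0 ∧
      ExtBoundaryTwo (u - u') := by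
  match i, u, h with
  | 0, u, h => exact ⟨0, 0, AddSubgroup.mem_top _, rfl, 0, 0, rfl⟩
  | 1, u, h =>
    obtain ⟨y, hy⟩ := exists_mem_extRel_right ε u
    exact ⟨y, u, hy, rfl, 0, 0, by rw [map_zero, smul_zero, sub_self, add_zero]⟩
  | i + 2, u, ⟨t, ht⟩ =>
    -- The projector onto normalised chains is homotopic to the identity, and its image is killed by
    -- every face except the zeroth.
    let p : mooreComplex underlying Y ⟶ mooreComplex underlying Y := DoldKan.PInfty
    let K : Homotopy p (𝟙 _) := DoldKan.homotopyPInftyToId (applyLevelwise underlying Y)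
    have h₁ : ExtBoundaryTwo (u - extMap p (i + 3) u) := by
      have h₁ := extMap_homotopy K _ u
      rw [extMap_id, ht, map_nsmul] at h₁
      refine ⟨-extH K (i + 3) u, -extH K (i + 2) t, ?_⟩
      rw [h₁, map_neg, smul_neg]
      abel
    have h₂ := extMap_extD p (i + 2) u
    rw [ht, map_nsmul] at h₂
    set u' : Y.obj (op (.mk (i + 1))) := extMap p (i + 3) u
    set t' : Y.obj (op (.mk i)) := extMap p (i + 2) t
    have h₃ (j : Fin (i + 1)) : (Y.δ j.succ).hom u' = 0 := δ_PInfty_apply j u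
    have h₄ : (Y.δ 0).hom u' = 2 • t' := by
      have h₄ := h₂.trans (mooreComplex_d_apply underlying i u')
      rw [Fin.sum_univ_succ, Finset.sum_eq_zero, add_zero] at h₄
      · exact (h₄.trans (one_smul ℤ ((Y.δ 0).hom u'))).symm
      · intro j _
        exact (congrArg (_ • ·) (h₃ j)).trans (smul_zero _)
    refine ⟨(tateCoeff ε • (u' ⊗ₜ[ZMod 4] u') : Y.obj (op (.mk (i + 1))) ⊗[ZMod 4] _), u',
      tmul_self_mem_tensorRel (M := Y.obj (op (.mk (i + 1)))) ε u', ?_, h₁⟩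
    refine (mooreComplex_d_apply tensorSquare i _).trans (Finset.sum_eq_zero fun j _ => ?_)
    -- Squaring turns evenness into vanishing: each face of `u' ⊗ u'` is zero, so it is a cycle and
    -- not only one modulo two.
    have h₅ : (Y.δ j).hom u' ⊗ₜ[ZMod 4] (Y.δ j).hom u' = 0 := by
      induction j using Fin.cases with
      | zero => rw [h₄, two_nsmul_tmul_two_nsmul]
      | succ j => rw [h₃, TensorProduct.tmul_zero]
    refine (congrArg (_ • ·) ((map_zsmul (tensorSquare.map (Y.δ j)).hom _ _).trans
      ((congrArg (_ • ·) h₅).trans (smul_zero _)))).trans (smul_zero _)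

variable {T : ModuleCat.{0} (ZMod 4) ⥤ AddCommGrpCat.{0}} [T.PreservesZeroMorphisms]
  {X : SimplicialObject (ModuleCat.{0} (ZMod 4))}

lemma extD_eq_functorTower_d {n i : ℕ}
    (v : extObj (mooreComplex T (iteratedSuspension X n)) (i + 1)) :
    extD _ i v = (functorTower T X).d n i (towerSign n • v) := by
  change _ = towerSign n • extD _ i (towerSign n • v)
  rw [TateTower.map_units_smul, TateTower.units_smul_smul]

lemma functorTower_d_eq_zero_iff {n i : ℕ}
    (x : extObj (mooreComplex T (iteratedSuspension X n)) (i + 1)) :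
    (functorTower T X).d n i x = 0 ↔ extD _ i x = 0 :=
  smul_eq_zero_iff_eq (towerSign n)

lemma eq_two_nsmul_units_smul {A : Type*} [AddCommGroup A] {ε : ℤˣ} {x t : A}
    (h : ε • x = 2 • t) : x = 2 • ε • t := by
  rw [← TateTower.units_smul_smul ε x, h]
  exact (TateTower.map_units_smul (nsmulAddMonoidHom 2) ε t).symm

lemma cycleTwo_iff {n i : ℕ} (u : extObj (mooreComplex T (iteratedSuspension X n)) (i + 1)) :
    (functorTower T X).CycleTwo (n := n) (i := i) u ↔ ExtCycleTwo u := by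
  constructor
  · exact fun ⟨t, ht⟩ => ⟨_, eq_two_nsmul_units_smul (x := extD _ i u) ht⟩
  · exact fun ⟨t, ht⟩ => ⟨_, (congrArg (towerSign n • ·) ht).trans
      (TateTower.map_units_smul (nsmulAddMonoidHom 2) (towerSign n) t).symm⟩

lemma boundaryTwo_iff {n i : ℕ} (u : extObj (mooreComplex T (iteratedSuspension X n)) (i + 1)) :
    (functorTower T X).BoundaryTwo (n := n) (i := i) u ↔ ExtBoundaryTwo u := by
  constructor
  · rintro ⟨v, t, h⟩
    refine ⟨(towerSign n • v : extObj (mooreComplex T (iteratedSuspension X n)) (i + 2)), t,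
      h.trans (congrArg (· + _) ?_)⟩
    exact (TateTower.map_units_smul (extD _ (i + 1)) (towerSign n) v).symm
  · rintro ⟨v, t, rfl⟩
    exact ⟨_, t, congrArg (· + _) (extD_eq_functorTower_d v)⟩

end TensorTower

/-! ### Homology modulo two of iterated suspensions, and the Tate tower of a free model -/

section

variable {X : SimplicialObject (ModuleCat.{0} (ZMod 4))}

lemma ExtBoundaryTwo.add {A : ChainComplex AddCommGrpCat.{0} ℕ} {i : ℕ} {u u' : extObj A (i + 1)}
    (h : ExtBoundaryTwo u) (h' : ExtBoundaryTwo u') : ExtBoundaryTwo (u + u') := by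
  obtain ⟨v, t, rfl⟩ := h
  obtain ⟨v', t', rfl⟩ := h'
  exact ⟨v + v', t + t', by rw [map_add, smul_add]; abel⟩

section

variable {Y : SimplicialObject (ModuleCat.{0} (ZMod 4))} {i : ℕ}
  {x x' : extObj (mooreComplex underlying Y) (i + 1)}
  {y y' : extObj (mooreComplex underlying (suspension Y)) (i + 2)}

lemma ExtBoundaryTwo.of_sub_extS (hy : ExtBoundaryTwo (y - extS underlying Y (i + 1) x))
    (hx : ExtBoundaryTwo x) : ExtBoundaryTwo y := by
  obtain ⟨v, t, rfl⟩ := hx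
  have : ExtBoundaryTwo (extS underlying Y (i + 1) (extD _ (i + 1) v + 2 • t)) :=
    ⟨-extS underlying Y (i + 2) v, extS underlying Y (i + 1) t, by
      rw [map_add, map_nsmul, map_neg, extD_extS, neg_neg]⟩
  simpa using hy.add this

lemma ExtBoundaryTwo.sub_of_sub_extS (hy : ExtBoundaryTwo (y - extS underlying Y (i + 1) x))
    (hy' : ExtBoundaryTwo (y' - extS underlying Y (i + 1) x')) (h : ExtBoundaryTwo (x - x')) :
    ExtBoundaryTwo (y - y') := by
  refine of_sub_extS (x := x - x') ?_ h
  rw [map_sub, sub_sub_sub_comm]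
  exact hy.sub hy'

end

/-- Since `i ≤ n`, the class can be desuspended down to degree one, where the chain group is zero.
-/
lemma extBoundaryTwo_of_le {n i : ℕ} (hi : i ≤ n)
    {u : extObj (mooreComplex underlying (iteratedSuspension X n)) (i + 1)} (h : ExtCycleTwo u) :
    ExtBoundaryTwo u := by
  match n, i, hi, u, h with
  | _, 0, _, u, _ => exact ⟨0, 0, Subsingleton.elim (α := PUnit) _ _⟩
  | n + 1, i + 1, hi, u, h =>
    obtain ⟨x, hx, hb⟩ := exists_sub_extS h
    exact hb.of_sub_extS (extBoundaryTwo_of_le (Nat.le_of_succ_le_succ hi) hx)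

/-- Desuspension ends either at the free model itself or in degree one, where everything is zero. -/
lemma extBoundaryTwo_sub_iteratedSuspension (hX : IsFreeModel zmodTwo 0 X) {n i : ℕ}
    {u u' : extObj (mooreComplex underlying (iteratedSuspension X n)) (i + 1)}
    (hu : ExtCycleTwo u) (hu' : ExtCycleTwo u')
    (hb : ¬ ExtBoundaryTwo u) (hb' : ¬ ExtBoundaryTwo u') : ExtBoundaryTwo (u - u') := by
  match n, i, u, u', hu, hu', hb, hb' with
  | _, 0, _, _, _, _, _, _ => exact ⟨0, 0, Subsingleton.elim (α := PUnit) _ _⟩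
  | 0, i + 1, u, u', hu, hu', hb, hb' =>
    exact extBoundaryTwo_sub (X := X) hX hu hu' hb hb'
  | n + 1, i + 1, u, u', hu, hu', hb, hb' =>
    obtain ⟨x, hx, h⟩ := exists_sub_extS hu
    obtain ⟨x', hx', h'⟩ := exists_sub_extS hu'
    exact h.sub_of_sub_extS h' (extBoundaryTwo_sub_iteratedSuspension hX hx hx'
      (fun H => hb (h.of_sub_extS H)) (fun H => hb' (h'.of_sub_extS H)))

/-- The tower of tensor squares of the suspensions of a free model of `ℤ/2`. -/
def tensorTower (hX : IsFreeModel zmodTwo 0 X) : TateTower where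
  V := functorTower tensorSquare X
  U := functorTower underlying X
  swap n i := extSwap (iteratedSuspension X n) i
  swap_swap n i x := extSwap_extSwap i x
  swap_d n i x := (TateTower.map_units_smul (extSwap _ i) (towerSign n) _).trans
    (congrArg (towerSign n • ·) (extSwap_extD i x))
  swap_s n i x := extSwap_extS i x
  rel ε n i := extRel (iteratedSuspension X n) ε i
  rel_d {ε n i y u} h := zsmul_mem (extD_mem_extRel h) (towerSign n : ℤ)
  rel_s h := extS_mem_extRel h
  swap_eq_of_rel h := extSwap_eq_of_mem_extRel h
  exists_rel_left {ε n i y} h := exists_mem_extRel_left (hX.iteratedSuspension n).free h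
  exists_rel_right ε _ _ u := exists_mem_extRel_right ε u
  norm_rel ε _ _ w := norm_mem_extRel ε w
  eq_two_of_rel_zero {ε n i u} h := eq_two_nsmul_of_mem_extRel (hX.iteratedSuspension n).free h
  eq_norm_of_rel_two h := eq_norm_of_mem_extRel h
  exists_cycle_rel ε n i u h := by
    obtain ⟨y, u', h₁, h₂, h₃⟩ := exists_cycle_mem_extRel ε ((cycleTwo_iff u).1 h)
    exact ⟨y, u', h₁, (functorTower_d_eq_zero_iff y).2 h₂, (boundaryTwo_iff _).2 h₃⟩
  exists_s_eq_d {n i z} h := by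
    obtain ⟨v, hv⟩ := exists_extS_eq_extD ((functorTower_d_eq_zero_iff z).1 h)
    exact ⟨_, hv.trans (extD_eq_functorTower_d (X := X) (n := n + 1) v)⟩
  boundaryTwo_of_s {n i u} h h' := (boundaryTwo_iff u).2 (extBoundaryTwo_of_extS
    ((cycleTwo_iff u).1 h) ((boundaryTwo_iff (X := X) (n := n + 1) _).1 h'))
  boundaryTwo_of_le {n i} hi u h :=
    (boundaryTwo_iff u).2 (extBoundaryTwo_of_le hi ((cycleTwo_iff u).1 h))
  boundaryTwo_sub {n i u u'} h h' hu hu' := (boundaryTwo_iff _).2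
    (extBoundaryTwo_sub_iteratedSuspension hX ((cycleTwo_iff u).1 h) ((cycleTwo_iff u').1 h')
      (mt (boundaryTwo_iff u).2 hu) (mt (boundaryTwo_iff u').2 hu'))
  exists_not_boundaryTwo q := by
    obtain ⟨u, h, h'⟩ := exists_not_extBoundaryTwo hX q
    exact ⟨u, (cycleTwo_iff (X := X) (n := 0) u).2 h,
      mt (boundaryTwo_iff (X := X) (n := 0) u).1 h'⟩

end

/-! ### Classes of cycles in the homology of complexes of abelian groups -/

section HomologyClass

variable (S : ShortComplex AddCommGrpCat.{0})

/-- The homology class of a cycle. -/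
def abClass : S.g.hom.ker →+ S.homology :=
  (S.abCyclesIso.inv ≫ S.homologyπ).hom

lemma abClass_surjective : Function.Surjective (abClass S) :=
  (AddCommGrpCat.epi_iff_surjective (S.abCyclesIso.inv ≫ S.homologyπ)).1 inferInstance

variable {S}

lemma iCycles_injective : Function.Injective S.iCycles :=
  (AddCommGrpCat.mono_iff_injective S.iCycles).1 inferInstance

lemma abClass_eq_zero_iff (z : S.g.hom.ker) : abClass S z = 0 ↔ ∃ x, S.f.hom x = z.1 := by
  have hS := (ShortComplex.mk _ _ S.toCycles_comp_homologyπ).exact_of_g_is_cokernel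
    S.homologyIsCokernel
  rw [ShortComplex.ab_exact_iff] at hS
  have hz := S.abCyclesIso_inv_apply_iCycles z
  constructor
  · intro h
    obtain ⟨x, hx⟩ := hS (S.abCyclesIso.inv z) h
    refine ⟨x, ?_⟩
    rw [← hz, ← hx]
    exact congrArg (fun g => g.hom x) S.toCycles_i.symm
  · rintro ⟨x, hx⟩
    have : S.toCycles x = S.abCyclesIso.inv z := by
      refine iCycles_injective (Eq.trans ?_ (hx.trans hz.symm))
      exact congrArg (fun g => g.hom x) S.toCycles_i
    change S.homologyπ (S.abCyclesIso.inv z) = 0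
    rw [← this]
    exact congrArg (fun g => g.hom x) S.toCycles_comp_homologyπ

lemma homologyMap_abClass {S' : ShortComplex AddCommGrpCat.{0}} (φ : S ⟶ S') (z : S.g.hom.ker)
    (z' : S'.g.hom.ker) (h : φ.τ₂.hom z.1 = z'.1) :
    (ShortComplex.homologyMap φ).hom (abClass S z) = abClass S' z' := by
  have : ShortComplex.cyclesMap φ (S.abCyclesIso.inv z) = S'.abCyclesIso.inv z' := by
    refine iCycles_injective (Eq.trans ?_ (S'.abCyclesIso_inv_apply_iCycles z').symm)
    rw [← h, ← S.abCyclesIso_inv_apply_iCycles z]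
    exact congrArg (fun g => g.hom (S.abCyclesIso.inv z)) (ShortComplex.cyclesMap_i φ)
  refine (congrArg (fun g => g.hom (S.abCyclesIso.inv z))
    (ShortComplex.homologyπ_naturality φ)).trans ?_
  exact congrArg S'.homologyπ.hom this

variable {A B : ChainComplex AddCommGrpCat.{0} ℕ}

lemma sc_g_eq_zero_iff (i : ℕ) (x : A.X i) :
    (A.sc i).g.hom x = 0 ↔ extD A (i + 1) (x : extObj A (i + 2)) = 0 := by
  match i, x with
  | 0, x =>
    have h : (A.sc 0).g = 0 := A.shape _ _ (by simp)
    rw [h]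
    exact ⟨fun _ => rfl, fun _ => rfl⟩
  | i + 1, x =>
    have (j) (hj : (ComplexShape.down ℕ).next (i + 1) = j) :
        (A.sc (i + 1)).g.hom x = 0 ↔ (A.d (i + 1) j).hom x = 0 := by
      subst hj
      rfl
    exact this i (by simp)

lemma exists_sc_f_eq_iff (i : ℕ) (x : A.X i) :
    (∃ v, (A.sc i).f.hom v = x) ↔ ∃ v, extD A (i + 2) v = x := by
  have (j) (hj : (ComplexShape.down ℕ).prev i = j) :
      (∃ v, (A.sc i).f.hom v = x) ↔ ∃ v, (A.d j i).hom v = x := by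
    subst hj
    rfl
  exact this (i + 1) (by simp)

variable (A) in
/-- The homology class of a cycle of a chain complex. -/
def chainClass (i : ℕ) : (extD A (i + 1)).ker →+ A.homology i :=
  (abClass (A.sc i)).comp (AddMonoidHom.mk' (fun z => ⟨z.1, (sc_g_eq_zero_iff i _).2 z.2⟩)
    fun _ _ => rfl)

lemma chainClass_surjective (i : ℕ) : Function.Surjective (chainClass A i) := fun a => by
  obtain ⟨z, rfl⟩ := abClass_surjective (A.sc i) a
  exact ⟨⟨z.1, (sc_g_eq_zero_iff i _).1 z.2⟩, rfl⟩

lemma chainClass_eq_zero_iff {i : ℕ} (z : (extD A (i + 1)).ker) :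
    chainClass A i z = 0 ↔ ∃ v, extD A (i + 2) v = z.1 :=
  (abClass_eq_zero_iff _).trans (exists_sc_f_eq_iff i _)

lemma homologyShift_chainClass (K : Homotopy (0 : A ⟶ B) 0) (i : ℕ) (z : (extD A (i + 1)).ker)
    (z' : (extD B (i + 2)).ker) (h : extH K (i + 2) z.1 = z'.1) :
    (homologyShift K i).hom (chainClass A i z) = chainClass B (i + 1) z' :=
  homologyMap_abClass _ _ _ h

end HomologyClass

/-! ### Symmetric tensors in the tensor squares -/

section SymmetricTensors

/-- The inclusion of the symmetric tensors. -/
def symmetricInclusion : F (ZMod 4) ⟶ tensorSquare where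
  app M := AddCommGrpCat.ofHom (symmetricTensors (ZMod 4) M).subtype.toAddMonoidHom
  naturality _ _ _ := rfl

variable {Y : SimplicialObject (ModuleCat.{0} (ZMod 4))}

variable (Y) in
/-- The inclusion of the symmetric tensors in the extended complexes. -/
def extInclusion (i : ℕ) :
    extObj (mooreComplex (F (ZMod 4)) Y) i →+ extObj (mooreComplex tensorSquare Y) i :=
  extMap ((alternatingFaceMapComplex _).map
    (((SimplicialObject.whiskering _ _).map symmetricInclusion).app Y)) i

lemma extInclusion_injective (i : ℕ) : Function.Injective (extInclusion Y i) := by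
  match i with
  | 0 => exact fun _ _ _ => rfl
  | 1 => exact fun _ _ _ => rfl
  | i + 2 => exact fun x y h => Subtype.ext h

lemma extSwap_eq_iff {i : ℕ} {y : extObj (mooreComplex tensorSquare Y) i} :
    extSwap Y i y = y ↔ ∃ x, extInclusion Y i x = y := by
  match i, y with
  | 0, _ => exact ⟨fun _ => ⟨0, rfl⟩, fun _ => rfl⟩
  | 1, _ => exact ⟨fun _ => ⟨0, rfl⟩, fun _ => rfl⟩
  | i + 2, y => exact ⟨fun h => ⟨⟨y, h⟩, rfl⟩, fun ⟨x, hx⟩ => hx ▸ x.2⟩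

lemma extInclusion_extS (i : ℕ) (x : extObj (mooreComplex (F (ZMod 4)) Y) i) :
    extInclusion (suspension Y) (i + 1) (extS (F (ZMod 4)) Y i x) =
      extS tensorSquare Y i (extInclusion Y i x) := by
  match i, x with
  | 0, _ => rfl
  | 1, _ => exact map_zero (extInclusion (suspension Y) 2)
  | i + 2, x =>
    refine (congrArg (symmetricInclusion.app _).hom
      (suspensionHomotopy_hom_apply (F (ZMod 4)) i x)).trans
      (Eq.trans ?_ (suspensionHomotopy_hom_apply tensorSquare i _).symm)
    rw [map_neg, map_sum]
    simp only [map_zsmul]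
    rfl

end SymmetricTensors

/-! ### The stable derived functors of `F` as stable homology of symmetric tensors -/

section Link

variable {X : SimplicialObject (ModuleCat.{0} (ZMod 4))} (hX : IsFreeModel zmodTwo 0 X)

/-- The Moore complex of the symmetric tensors of a suspension. -/
abbrev symComplex (X : SimplicialObject (ModuleCat.{0} (ZMod 4))) (n : ℕ) :=
  mooreComplex (F (ZMod 4)) (iteratedSuspension X n)

lemma mem_eigen_one_iff {n i : ℕ} {y : (tensorTower hX).V.C n i} :
    y ∈ (tensorTower hX).eigen 1 n i ↔ ∃ x, extInclusion (iteratedSuspension X n) i x = y := by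
  rw [TateTower.mem_eigen, one_smul]
  exact extSwap_eq_iff

lemma mem_cycles_one_iff {n i : ℕ} {x : extObj (symComplex X n) (i + 1)} :
    extInclusion (iteratedSuspension X n) (i + 1) x ∈ (tensorTower hX).cycles 1 n i ↔
      x ∈ (extD _ i).ker := by
  rw [AddMonoidHom.mem_ker]
  have h : (tensorTower hX).V.d n i (extInclusion (iteratedSuspension X n) (i + 1) x) = 0 ↔
      extD _ i x = 0 := by
    refine (functorTower_d_eq_zero_iff _).trans ?_
    rw [extInclusion, ← extMap_extD]
    exact (extInclusion_injective i).eq_iff' (map_zero _)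
  exact ⟨fun hx => h.1 hx.2, fun hx => ⟨(mem_eigen_one_iff hX).2 ⟨x, rfl⟩, h.2 hx⟩⟩

/-- The symmetric cycles are the cycles of the symmetric tensors. -/
def symmetricCycles (n i : ℕ) :
    (tensorTower hX).cycles 1 n i ≃+ (extD (symComplex X n) i).ker :=
  AddEquiv.symm <| AddEquiv.ofBijective
    (((extInclusion (iteratedSuspension X n) (i + 1)).comp
      (AddSubgroup.subtype _)).codRestrict _ fun z => (mem_cycles_one_iff hX).2 z.2)
    ⟨fun x y h => Subtype.ext (extInclusion_injective _ (congrArg Subtype.val h)), fun z => by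
      obtain ⟨x, hx⟩ := (mem_eigen_one_iff hX).1 z.2.1
      exact ⟨⟨x, (mem_cycles_one_iff hX).1 (hx ▸ z.2)⟩, Subtype.ext hx⟩⟩

lemma extInclusion_symmetricCycles {n i : ℕ} (z : (tensorTower hX).cycles 1 n i) :
    extInclusion (iteratedSuspension X n) (i + 1) (symmetricCycles hX n i z).1 = z.1 :=
  congrArg Subtype.val ((symmetricCycles hX n i).symm_apply_apply z)

/-- The class of a symmetric cycle. -/
def symmetricClass (n j : ℕ) : (tensorTower hX).cycles 1 n (j + 1) →+
    leftDerived (F (ZMod 4)) (iteratedSuspension X n) j :=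
  (chainClass (symComplex X n) j).comp (symmetricCycles hX n (j + 1)).toAddMonoidHom

lemma symmetricClass_surjective (n j : ℕ) : Function.Surjective (symmetricClass hX n j) :=
  (chainClass_surjective j).comp (symmetricCycles hX n (j + 1)).surjective

lemma symmetricClass_eq_zero_iff {n j : ℕ} (z : (tensorTower hX).cycles 1 n (j + 1)) :
    symmetricClass hX n j z = 0 ↔ ∃ v ∈ (tensorTower hX).eigen 1 n (j + 3),
      (tensorTower hX).V.d n (j + 2) v = z.1 := by
  have key (x : extObj (symComplex X n) (j + 3)) :
      (tensorTower hX).V.d n (j + 2) (extInclusion (iteratedSuspension X n) (j + 3) x) =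
        extInclusion (iteratedSuspension X n) (j + 2) (extD _ (j + 2) (towerSign n • x)) := by
    refine Eq.trans ?_ (extMap_extD _ (j + 2) (towerSign n • x)).symm
    rw [TateTower.map_units_smul, TateTower.map_units_smul]
    rfl
  refine (chainClass_eq_zero_iff _).trans ⟨fun ⟨v, hv⟩ => ?_, fun ⟨w, hw, hz⟩ => ?_⟩
  -- The factor cancels the sign carried by the differential of the tower.
  · refine ⟨extInclusion (iteratedSuspension X n) (j + 3) (towerSign n • v),
      (mem_eigen_one_iff hX).2 ⟨_, rfl⟩, ?_⟩
    rw [key, TateTower.units_smul_smul, hv]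
    exact extInclusion_symmetricCycles hX z
  · obtain ⟨x, rfl⟩ := (mem_eigen_one_iff hX).1 hw
    refine ⟨towerSign n • x, extInclusion_injective _ ?_⟩
    exact (key x).symm.trans (hz.trans (extInclusion_symmetricCycles hX z).symm)

lemma suspensionMap_symmetricClass {n j : ℕ} (z : (tensorTower hX).cycles 1 n (j + 1)) :
    (suspensionMap (F (ZMod 4)) (iteratedSuspension X n) j).hom (symmetricClass hX n j z) =
      symmetricClass hX (n + 1) (j + 1) ⟨_, TateTower.s_mem_cycles z.2⟩ := by
  refine homologyShift_chainClass _ _ _ _ ?_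
  apply extInclusion_injective (Y := iteratedSuspension X (n + 1))
  refine Eq.trans ?_ (extInclusion_symmetricCycles hX (n := n + 1) (i := j + 2)
    ⟨_, TateTower.s_mem_cycles z.2⟩).symm
  refine (extInclusion_extS _ _).trans ?_
  exact congrArg _ (extInclusion_symmetricCycles hX z)

/-- The left stable derived functors of `F` are the stable homology groups of the symmetric
tensors. -/
def stableHomologyF (q : ℕ) :
    (tensorTower hX).StableHomology 1 (q + 1) (leftStableDerived (F (ZMod 4)) X q) :=
  .ofSequence (fun n => suspensionMap (F (ZMod 4)) (iteratedSuspension X n) (q + n))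
    -- Index `q + 1` means degree `q + n + 2` of the extended complex, that is, degree `q + n` of
    -- the Moore complex.
    (fun n i h => (show i = q + n + 1 by omega) ▸ symmetricClass hX n (q + n))
    (fun n i h z => by
      obtain rfl : i = q + n + 1 := by omega
      exact suspensionMap_symmetricClass hX z)
    (fun n i h => by
      obtain rfl : i = q + n + 1 := by omega
      exact symmetricClass_surjective hX n (q + n))
    (fun n i h z => by
      obtain rfl : i = q + n + 1 := by omega
      exact symmetricClass_eq_zero_iff hX z)

end Link

end StableDerived

end

theorem mainTheorem7 :
    (∀ (q : ℕ) (X : CategoryTheory.SimplicialObject (ModuleCat.{0} (ZMod 4))),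
      StableDerived.IsFreeModel StableDerived.zmodTwo 0 X →
        Nonempty
          (StableDerived.leftStableDerived (StableDerived.F (ZMod 4)) X q ≃+
            (Fin (q + 1) → ZMod 2))) ∧
    Nonempty
      (StableDerived.freeInclusion (ZMod 4) ⋙ StableDerived.F (ZMod 4) ≅
        StableDerived.freeInclusion (ZMod 4) ⋙ StableDerived.Whitehead (ZMod 4) ⋙
          forget₂ (ModuleCat.{0} (ZMod 4)) AddCommGrpCat.{0}) := by
  refine ⟨fun q X hX => ?_, ⟨StableDerived.freeIso⟩⟩
  exact StableDerived.TateTower.nonempty_stableHomology_addEquiv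
    (S := StableDerived.tensorTower hX) (fun _ => inferInstanceAs (Subsingleton PUnit))
    (StableDerived.stableHomologyF hX q)
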